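/- Let $B$ be a smooth complex algebraic variety (a separated scheme of finite type over $\mathbb{C}$, smooth of pure dimension $n$), let $L_1,\ldots,L_r$ be invertible sheaves on $B$, and let $b=(b_1,\ldots,b_r)\in H^0(B,\bigoplus_{i=1}^r L_i)$ be a nonzero section. Spaces of complex points carry the analytic topology, and cohomology is sheaf cohomology with complex coefficients. For a closed subset $D$ of a space $F$, with $v:F\setminus D\to F$ the inclusion, put $H^m(F,D)=H^m(F,v_!\mathbb{C})$. Let $E$ be the total space of $L_1^\vee\oplus\cdots\oplus L_r^\vee$, with points $(x,\ell_1,\ldots,\ell_r)$, where $x\in B$ and $\ell_i$ is a linear form on the fiber $L_i(x)$. Let $\varphi_b(x,\ell_1,\ldots,\ell_r)=\sum_i\langle\ell_i,b_i(x)\rangle$, let $F_b=\varphi_b^{-1}(1)\subset E$, let $D_i\subset E$ be the locus $\ell_i=0$, and let $E_i=F_b\cap D_i$. Let $Y_i\subset B$ be the zero locus of $b_i$ and $U_i=B\setminus Y_i$. Let $\mathbb{P}=\mathrm{Proj}\,\mathrm{Sym}^\bullet(L_1\oplus\cdots\oplus L_r)$, which is the quotient of the complement of the zero section of $E$ by the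 scaling action of $\mathbb{C}^*$; let $\mathbb{U}_b\subset\mathbb{P}$ be the locus where the section of $\mathcal{O}_{\mathbb{P}}(1)$ defined by $b$ (that is, $\varphi_b$) does not vanish, let $\mathbb{D}_i\subset\mathbb{P}$ be the image of $D_i$ minus the zero section, and let $\mathbb{D}=\bigcup_i\mathbb{D}_i$. Then for every integer $m$ there is an isomorphism of complex vector spaces $$H^{m+r-1}\Big(F_b,\bigcup_i E_i\Big)\cong H^m(U_1\cap\cdots\cap U_r),$$ where cohomology in negative degrees is zero; in particular $H^k(F_b,\bigcup_i E_i)=0$ for $k<r-1$. Moreover, the projection from $E$ minus its zero section to $\mathbb{P}$ restricts to a homeomorphism $F_b\to\mathbb{U}_b$ that maps $E_i$ onto $\mathbb{U}_b\cap\mathbb{D}_i$ for every $i$, and for every integer $m$ $$H^{m+r-1}(\mathbb{U}_b,\mathbb{U}_b\cap\mathbb{D})\cong H^m\Big(B\setminus\bigcup_i Y_i\Big),$$ so that $H^k(\mathbb{U}_b,\mathbb{U}_b\cap\mathbb{D})=0$ for $k<r-1$. -/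

import Mathlib

open CategoryTheory AlgebraicGeometry TopologicalSpace

noncomputable section

namespace MilnorFiber

/-! ### Sheaf cohomology with complex coefficients -/

/-- The category of sheaves of complex vector spaces on a topological space. -/
abbrev VectSheaf (X : Type) [TopologicalSpace X] :=
  Sheaf (Opens.grothendieckTopology (TopCat.of X)) (ModuleCat.{0} ℂ)

/-- The constant sheaf `ℂ_X`. -/
abbrev constSheaf (X : Type) [TopologicalSpace X] : VectSheaf X :=
  (constantSheaf (Opens.grothendieckTopology (TopCat.of X)) (ModuleCat.{0} ℂ)).obj
    (ModuleCat.of ℂ ℂ)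

/-- The sheaf cohomology `H^m(X, 𝓕) = Ext^m(ℂ_X, 𝓕)`, a complex vector space. -/
abbrev SheafCohomology (X : Type) [TopologicalSpace X] (S : VectSheaf X) (m : ℕ) : Type :=
  Abelian.Ext.{0} (constSheaf X) S m

/-- The cohomology `H^m(X) = H^m(X, ℂ_X)`. -/
abbrev Cohomology (X : Type) [TopologicalSpace X] (m : ℕ) : Type :=
  SheafCohomology X (constSheaf X) m

section ExtensionByZero

variable {X : Type} [TopologicalSpace X]

/-- The locally constant complex functions on an open set `V` that vanish on `V ∩ D`. -/
def extByZeroSections (D : Set X) (V : Opens X) : Submodule ℂ (V → ℂ) where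
  carrier := {g | IsLocallyConstant g ∧ ∀ x : V, (x : X) ∈ D → g x = 0}
  add_mem' := fun {g h} hg hh =>
    ⟨hg.1.add hh.1, fun x hx => by simp [hg.2 x hx, hh.2 x hx]⟩
  zero_mem' := ⟨IsLocallyConstant.const 0, fun _ _ => rfl⟩
  smul_mem' := fun c g hg =>
    ⟨hg.1.comp (fun z => c • z), fun x hx => by simp [hg.2 x hx]⟩

/-- Restriction of sections to a smaller open set. -/
def extByZeroRes (D : Set X) {V W : Opens X} (h : W ≤ V) :
    extByZeroSections D V →ₗ[ℂ] extByZeroSections D W where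
  toFun g := ⟨fun x => g.1 ⟨x.1, h x.2⟩,
    g.2.1.comp_continuous (by fun_prop : Continuous fun x : W => (⟨x.1, h x.2⟩ : V)),
    fun x hx => g.2.2 ⟨x.1, h x.2⟩ hx⟩
  map_add' _ _ := rfl
  map_smul' _ _ := rfl

/-- The presheaf underlying `extByZero`. -/
def extByZeroPresheaf (D : Set X) : TopCat.Presheaf (ModuleCat.{0} ℂ) (TopCat.of X) where
  obj V := ModuleCat.of ℂ (extByZeroSections D V.unop)
  map i := ModuleCat.ofHom (extByZeroRes D (leOfHom i.unop))
  map_id _ := rfl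
  map_comp _ _ := rfl

theorem extByZeroPresheaf_isSheaf (D : Set X) : (extByZeroPresheaf D).IsSheaf := by
  rw [TopCat.Presheaf.isSheaf_iff_isSheaf_comp (forget (ModuleCat.{0} ℂ))]
  apply TopCat.Presheaf.isSheaf_of_isSheafUniqueGluing_types
  intro ι U sf hsf
  let sf' : ∀ i, extByZeroSections D (U i) := sf
  have compat : ∀ i j (x : X) (hi : x ∈ U i) (hj : x ∈ U j),
      (sf' i).1 ⟨x, hi⟩ = (sf' j).1 ⟨x, hj⟩ := by
    intro i j x hi hj
    have h1 := hsf i j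
    have h2 : extByZeroRes D (inf_le_left : U i ⊓ U j ≤ U i) (sf' i) =
        extByZeroRes D (inf_le_right : U i ⊓ U j ≤ U j) (sf' j) := h1
    exact congrFun (congrArg Subtype.val h2) ⟨x, hi, hj⟩
  have hmem : ∀ x : ↥(iSup U : Opens X), ∃ i, (x : X) ∈ U i := fun x => Opens.mem_iSup.1 x.2
  choose c hc using hmem
  let g : ↥(iSup U : Opens X) → ℂ := fun x => (sf' (c x)).1 ⟨x.1, hc x⟩
  have hg : ∀ i (x : X) (hx : x ∈ U i),
      g ⟨x, Opens.mem_iSup.2 ⟨i, hx⟩⟩ = (sf' i).1 ⟨x, hx⟩ := fun i x hx => compat _ _ _ _ _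
  have hloc : IsLocallyConstant g := by
    rw [IsLocallyConstant.iff_eventually_eq]
    intro x
    have h1 := (IsLocallyConstant.iff_eventually_eq _).1 (sf' (c x)).2.1 ⟨x.1, hc x⟩
    rw [nhds_subtype_eq_comap, Filter.eventually_comap] at h1 ⊢
    filter_upwards [h1, (U (c x)).isOpen.mem_nhds (hc x)] with y hy hyU z hz
    subst hz
    have := hy ⟨z.1, hyU⟩ rfl
    rw [← hg (c x) z.1 hyU] at this
    exact this
  refine ⟨(⟨g, hloc, fun x hx => (sf' (c x)).2.2 ⟨x.1, hc x⟩ hx⟩ :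
      extByZeroSections D (iSup U)), ?_, ?_⟩
  · intro i
    apply Subtype.ext
    funext x
    exact hg i x.1 x.2
  · intro t ht
    apply Subtype.ext
    funext x
    have h1 : extByZeroRes D (le_iSup U (c x)) (t : extByZeroSections D (iSup U)) = sf' (c x) :=
      ht (c x)
    exact congrFun (congrArg Subtype.val h1) ⟨x.1, hc x⟩

/-- For a closed subset `D` of `X` with open complement `v : X ∖ D → X`, the extension by zero
`v_! ℂ` of the constant sheaf. A section of `v_! ℂ` on `V` is a locally constant function on
`V ∖ D` whose support is closed in `V`; extended by zero, such functions are the locally constant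
functions on `V` that vanish on `V ∩ D`. -/
def extByZero (D : Set X) : VectSheaf X :=
  ⟨extByZeroPresheaf D, extByZeroPresheaf_isSheaf D⟩

end ExtensionByZero

/-- The relative cohomology `H^m(X, D) = H^m(X, v_! ℂ_{X ∖ D})` for a closed subset `D`. -/
abbrev RelCohomology (X : Type) [TopologicalSpace X] (D : Set X) (m : ℕ) : Type :=
  SheafCohomology X (extByZero D) m

/-! ### Complex points with the analytic topology, fibers of sheaves of modules -/

section Points

variable {B : Scheme.{0}}

/-- An invertible sheaf: a sheaf of modules that is locally isomorphic to the structure sheaf. -/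
def IsInvertible (L : B.Modules) : Prop :=
  ∀ p : B, ∃ U : B.Opens, p ∈ U ∧
    Nonempty (L.restrict U.ι ≅
      (SheafOfModules.unit U.toScheme.ringCatSheaf : U.toScheme.Modules))

variable {f : B ⟶ Spec (CommRingCat.of ℂ)}

/-- The complex points of a scheme over `ℂ`. -/
def ComplexPoint (f : B ⟶ Spec (CommRingCat.of ℂ)) : Type :=
  {x : Spec (CommRingCat.of ℂ) ⟶ B // x ≫ f = 𝟙 _}

/-- The point of the underlying space of the scheme. -/
def ComplexPoint.pt (x : ComplexPoint f) : B := x.1 (IsLocalRing.closedPoint ℂ)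

/-- Evaluation of germs of regular functions at a complex point. -/
def ComplexPoint.evalGerm (x : ComplexPoint f) : B.presheaf.stalk x.pt →+* ℂ :=
  (Scheme.stalkClosedPointTo x.1).hom

/-- `ℂ` as an algebra over the local ring at a complex point, by evaluation. -/
instance evalAlgebra (x : ComplexPoint f) : Algebra (B.presheaf.stalk x.pt) ℂ :=
  x.evalGerm.toAlgebra

/-- The analytic topology: the coarsest one for which Zariski open sets are open and regular
functions on them are continuous. -/
instance : TopologicalSpace (ComplexPoint f) :=
  generateFrom {S | ∃ (V : B.Opens) (g : Γ(B, V)) (O : Set ℂ), IsOpen O ∧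
    S = {x | ∃ h : x.pt ∈ V, x.evalGerm (B.presheaf.germ V x.pt h g) ∈ O}}

/-- The stalk of a presheaf of modules is a module over the stalk of the structure sheaf. -/
@[reducible]
def presheafStalkModule (M : PresheafOfModules.{0} (B.presheaf ⋙ forget₂ CommRingCat RingCat))
    (p : B) : Module (B.presheaf.stalk p) ↑(TopCat.Presheaf.stalk M.presheaf p) :=
  inferInstance

instance stalkModule (L : B.Modules) (p : B) :
    Module (B.presheaf.stalk p) (L.presheaf.stalk p) :=
  presheafStalkModule L.val p

/-- The fiber `L(x) = ℂ ⊗ L_x` at a complex point, the tensor product being over `𝒪_{B,x}`. -/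
abbrev Fiber (L : B.Modules) (x : ComplexPoint f) : Type :=
  TensorProduct (B.presheaf.stalk x.pt) ℂ (L.presheaf.stalk x.pt)

/-- The value `s(x) = 1 ⊗ s_x` in the fiber at `x` of a section `s` of `L` over `V ∋ x`. -/
def valueAt (L : B.Modules) (x : ComplexPoint f) {V : B.Opens} (h : x.pt ∈ V) (s : Γ(L, V)) :
    Fiber L x :=
  TensorProduct.tmul (B.presheaf.stalk x.pt) (1 : ℂ) (L.presheaf.germ V x.pt h s)

/-- The zero locus `Y ⊆ B(ℂ)` of a global section. -/
def zeroLocus (f : B ⟶ Spec (CommRingCat.of ℂ)) {L : B.Modules} (s : Γ(L, ⊤)) :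
    Set (ComplexPoint f) :=
  {x | valueAt L x (Opens.mem_top _) s = 0}

end Points

/-! ### The vector bundle, the generalized Milnor fiber and the projective bundle -/

section Bundle

variable {B : Scheme.{0}} {r : ℕ}

/-- The complex points of the geometric vector bundle `E` associated with
`L_1^∨ ⊕ ⋯ ⊕ L_r^∨`: a complex point `x` of `B` with linear forms `ℓ_i` on the fibers
`L_i(x)`. -/
structure BundlePoint (f : B ⟶ Spec (CommRingCat.of ℂ)) (L : Fin r → B.Modules) : Type where
  base : ComplexPoint f
  coord : ∀ i, Module.Dual ℂ (Fiber (L i) base)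

variable {f : B ⟶ Spec (CommRingCat.of ℂ)} {L : Fin r → B.Modules}

/-- The analytic topology of the total space: the coarsest one for which the projection to `B(ℂ)`
and the fiberwise linear functions `⟨ℓ_i, s(x)⟩`, for local sections `s` of `L_i`, are
continuous. -/
instance : TopologicalSpace (BundlePoint f L) :=
  generateFrom ({S | ∃ W : Set (ComplexPoint f), IsOpen W ∧ S = BundlePoint.base ⁻¹' W} ∪
    {S | ∃ (i : Fin r) (V : B.Opens) (s : Γ(L i, V)) (O : Set ℂ), IsOpen O ∧
      S = {p | ∃ h : p.base.pt ∈ V, p.coord i (valueAt (L i) p.base h s) ∈ O}})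

/-- The function `φ_b(x, ℓ_1, …, ℓ_r) = ∑ ⟨ℓ_i, b_i(x)⟩`. -/
def pairing (b : ∀ i, Γ(L i, ⊤)) (p : BundlePoint f L) : ℂ :=
  ∑ i, p.coord i (valueAt (L i) p.base (Opens.mem_top _) (b i))

/-- The divisor `D_i` of `E` where the `i`th coordinate vanishes. -/
def coordDivisor (f : B ⟶ Spec (CommRingCat.of ℂ)) (L : Fin r → B.Modules) (i : Fin r) :
    Set (BundlePoint f L) :=
  {p | p.coord i = 0}

/-- The generalized Milnor fiber `F_b = φ_b⁻¹(1)`. -/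
def milnorFiber (f : B ⟶ Spec (CommRingCat.of ℂ)) (b : ∀ i, Γ(L i, ⊤)) :
    Set (BundlePoint f L) :=
  {p | pairing b p = 1}

/-- The locus `E_i = F_b ∩ D_i`, as a subset of `F_b`. -/
def milnorDivisor (f : B ⟶ Spec (CommRingCat.of ℂ)) (b : ∀ i, Γ(L i, ⊤)) (i : Fin r) :
    Set (milnorFiber f b) :=
  Subtype.val ⁻¹' coordDivisor f L i

/-- The complement of the zero section of `E`. -/
def Punctured (f : B ⟶ Spec (CommRingCat.of ℂ)) (L : Fin r → B.Modules) : Type :=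
  {p : BundlePoint f L // p.coord ≠ 0}

instance : TopologicalSpace (Punctured f L) :=
  inferInstanceAs (TopologicalSpace {p : BundlePoint f L // p.coord ≠ 0})

/-- Two nonzero vectors are equivalent if they lie in the same fiber and differ by a nonzero
scalar. -/
instance scalingSetoid (f : B ⟶ Spec (CommRingCat.of ℂ)) (L : Fin r → B.Modules) :
    Setoid (Punctured f L) where
  r p q := ∃ c : ℂ, c ≠ 0 ∧ q.1 = ⟨p.1.base, c • p.1.coord⟩
  iseqv :=
    { refl := fun p => ⟨1, one_ne_zero, by rw [one_smul]⟩
      symm := by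
        rintro ⟨p, hp⟩ ⟨q, hq⟩ ⟨c, hc, h⟩
        dsimp only at h
        subst h
        exact ⟨c⁻¹, inv_ne_zero hc, by simp [smul_smul, hc]⟩
      trans := by
        rintro ⟨p, hp⟩ ⟨q, hq⟩ ⟨t, ht⟩ ⟨c, hc, h⟩ ⟨d, hd, h'⟩
        dsimp only at h h'
        subst h
        subst h'
        exact ⟨d * c, mul_ne_zero hd hc, by simp [smul_smul]⟩ }

/-- The complex points of `ℙ = Proj Sym (L_1 ⊕ ⋯ ⊕ L_r)`: the quotient, with the quotient
topology, of the complement of the zero section of `E` by the scaling action of `ℂ^*`. -/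
def ProjBundle (f : B ⟶ Spec (CommRingCat.of ℂ)) (L : Fin r → B.Modules) : Type :=
  Quotient (scalingSetoid f L)

instance : TopologicalSpace (ProjBundle f L) :=
  inferInstanceAs (TopologicalSpace (Quotient (scalingSetoid f L)))

/-- The class of a nonzero vector. -/
def ProjBundle.mk (p : Punctured f L) : ProjBundle f L := Quotient.mk _ p

/-- The locus `𝕌_b ⊆ ℙ` where the section of `𝒪(1)` given by `b` does not vanish. -/
def nonvanishingLocus (f : B ⟶ Spec (CommRingCat.of ℂ)) (b : ∀ i, Γ(L i, ⊤)) :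
    Set (ProjBundle f L) :=
  ProjBundle.mk '' {p | pairing b p.1 ≠ 0}

/-- The image `𝔻_i ⊆ ℙ` of the divisor `D_i`. -/
def projDivisor (f : B ⟶ Spec (CommRingCat.of ℂ)) (L : Fin r → B.Modules) (i : Fin r) :
    Set (ProjBundle f L) :=
  ProjBundle.mk '' {p | p.1 ∈ coordDivisor f L i}

end Bundle

end MilnorFiber

end

open MilnorFiber

/-!
# Cohomology of generalized Milnor fibers

Write `H(X, D)` for the relative cohomology of a closed subset `D`, and `D` also for the union of
the coordinate divisors. The argument is topological: both sides are computed by excision and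
homotopy invariance, and invertibility of the `L_i` enters only through the fact that a local
generator makes the fibers lines spanned by `b_i(x)` wherever this value is not zero.

For a closed embedding `f : Z → X` there is a short exact sequence
`0 → extByZero (D ∪ f(Z)) → extByZero D → f_* extByZero (f⁻¹ D) → 0` (`shortExact_extByZero`), and
pushforward along `f` does not change cohomology (`ext_push_equiv`). Hence, when one of the three
pairs `(X, D ∪ f(Z))`, `(Z, f⁻¹ D)`, `(X, D)` is acyclic, the cohomologies of the other two agree,
with a shift of degree in the last case (`restrict_equiv`, `enlarge_equiv`, `boundary_equiv`).

The source of acyclic pairs is `acyclic_of_contraction`: if a homotopy from a map into `D` to the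
identity preserves `D`, then `H(X, D) = 0`. The homotopy exhibits `H(X, D)` as a direct summand of
the cohomology of the cylinder `X × [0, 1]` relative to its bottom and to `D × [0, 1]`
(`ext_subsingleton_of_retract`), and the latter vanishes. For this, consider the sheaves on the
cylinder whose germs at `(x, c)` extend to a neighborhood of `{x} × [c, 1]`. If `G` is such a sheaf,
then sections of a quotient by `G` lift near each fiber `{x} × [0, 1]`, by gluing lifts over the
pieces of a subdivision of the interval. So the direct image on `X` of an injective resolution of
`G` is exact; it splits when the direct image of `G` is injective, as it is here, being zero
(`ext_subsingleton_of_rightExtendable`).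

On the Milnor fiber put `u = ⟨ℓ_i, b_i(x)⟩`. The closed region `|u| ≤ 1/2` contracts to `ℓ_i = 0`
by scaling `ℓ_i` to zero and the other coordinates by the factor that preserves `φ_b = 1`, and the
region `|u| ≥ 1/2` lies over the locus where `b_i ≠ 0`. By excision, removing the zero locus of
`b_i` does not change the cohomology relative to `D` (`relCohomology_insert`). Doing this for
every `i` leaves the part over `U = U_1 ∩ ⋯ ∩ U_r`, where the functions `c_i = ⟨ℓ_i, b_i(x)⟩`
identify the Milnor fiber with `U × {∑ c_i = 1}` and `D` with the union of the hyperplanes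
`c_i = 0` (`trivialization`). All but one of these hyperplanes form an acyclic pair with the whole
space, by a contraction to a vertex, and the remaining hyperplane is the same space with one
coordinate less. So `r - 1` boundary maps lead to `H(U)` (`relCohomology_simplex`).

Finally, a class in the projective bundle on which `φ_b` does not vanish has a unique
representative with `φ_b = 1`, and it depends continuously on the class (`milnorHomeomorph`).
-/


noncomputable section

namespace MilnorFiber

/-! ### Sheaves of complex vector spaces and their sections -/

section Sheaves

variable {X Y : TopCat.{0}}

/-- Sheaves of complex vector spaces on an object of `TopCat`. -/
abbrev Shf (X : TopCat.{0}) := Sheaf (Opens.grothendieckTopology X) (ModuleCat.{0} ℂ)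

/-- The pushforward `f_*`. -/
abbrev push (f : X ⟶ Y) : Shf X ⥤ Shf Y :=
  (Opens.map f).sheafPushforwardContinuous _ _ _

/-- The inverse image `f⁻¹`. -/
abbrev pull (f : X ⟶ Y) : Shf Y ⥤ Shf X :=
  (Opens.map f).sheafPullback _ _ _

/-- The adjunction between inverse image and pushforward. -/
def pullPushAdj (f : X ⟶ Y) : pull f ⊣ push f :=
  (Opens.map f).sheafAdjunctionContinuous _ _ _

instance (f : X ⟶ Y) : (push f).IsRightAdjoint := (pullPushAdj f).isRightAdjoint

instance (f : X ⟶ Y) : (pull f).IsLeftAdjoint := (pullPushAdj f).isLeftAdjoint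

instance (f : X ⟶ Y) : (push f).Additive where
  map_add := by intros; rfl

instance (f : X ⟶ Y) : (pull f).Additive := (pullPushAdj f).left_adjoint_additive

instance (f : X ⟶ Y) : (push f).Linear ℂ where
  map_smul := by intros; rfl

attribute [local instance] Limits.reflectsLimits_of_reflectsIsomorphisms in
instance (f : X ⟶ Y) : Limits.PreservesFiniteLimits (pull f) :=
  have : Limits.PreservesFiniteLimits
      ((Opens.map f).op.lan : _ ⥤ ((Opens X)ᵒᵖ ⥤ ModuleCat.{0} ℂ)) :=
    lan_preservesFiniteLimits_of_flat _ _
  Functor.sheafPullbackConstruction.preservesFiniteLimits _ _ _ _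

instance (f : X ⟶ Y) : Limits.PreservesFiniteColimits (pull f) := inferInstance

instance (f : X ⟶ Y) : Limits.PreservesFiniteLimits (push f) := inferInstance

instance (f : X ⟶ Y) : (push f).PreservesInjectiveObjects where
  injective_obj _ := Injective.injective_of_adjoint (pullPushAdj f) _

lemma injective_push (f : X ⟶ Y) {J : Shf X} (hJ : Injective J) : Injective ((push f).obj J) :=
  Functor.PreservesInjectiveObjects.injective_obj hJ

/-- The whole space is terminal among the open sets. -/
def isTerminalTop : Limits.IsTerminal (⊤ : Opens X) :=
  Limits.IsTerminal.ofUniqueHom (fun _ => homOfLE le_top) (fun _ _ => rfl)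

/-- The constant sheaf `ℂ`. -/
abbrev cst (X : TopCat.{0}) : Shf X :=
  (constantSheaf (Opens.grothendieckTopology X) (ModuleCat.{0} ℂ)).obj (ModuleCat.of ℂ ℂ)

/-- The sections of a sheaf over an open set. -/
abbrev Sec (G : Shf X) (U : Opens X) : Type := G.obj.obj (.op U)

/-- Restriction of sections. -/
abbrev res (G : Shf X) {U V : Opens X} (h : V ≤ U) (s : Sec G U) : Sec G V :=
  (G.obj.map (homOfLE h).op).hom s

/-- A morphism of sheaves on sections. -/
abbrev app {G H : Shf X} (g : G ⟶ H) {U : Opens X} (s : Sec G U) : Sec H U :=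
  (g.hom.app (.op U)).hom s

lemma app_comp {F G H : Shf X} (f : F ⟶ G) (g : G ⟶ H) {U : Opens X} (s : Sec F U) :
    app (f ≫ g) s = app g (app f s) := rfl

lemma app_res {G H : Shf X} (g : G ⟶ H) {U V : Opens X} (h : V ≤ U) (s : Sec G U) :
    app g (res G h s) = res H h (app g s) :=
  ConcreteCategory.congr_hom (g.hom.naturality (homOfLE h).op) s

lemma res_res (G : Shf X) {U V W : Opens X} (h : V ≤ U) (k : W ≤ V) (s : Sec G U) :
    res G k (res G h s) = res G (k.trans h) s := by
  simp only [res]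
  rw [← ModuleCat.comp_apply, ← Functor.map_comp]
  rfl

lemma res_self (G : Shf X) {U : Opens X} (h : U ≤ U) (s : Sec G U) : res G h s = s := by
  simp [res]

/-- The global section corresponding to a morphism from the constant sheaf. -/
def sec {G : Shf X} (f : cst X ⟶ G) : Sec G ⊤ :=
  (((constantSheafAdj _ _ isTerminalTop).homEquiv _ _ f).hom : ℂ →ₗ[ℂ] _) (1 : ℂ)

/-- Global sections are morphisms from the constant sheaf. -/
lemma sec_bijective (G : Shf X) : Function.Bijective (sec (X := X) (G := G)) := by
  exact ((((constantSheafAdj (Opens.grothendieckTopology X) (ModuleCat.{0} ℂ)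
    isTerminalTop).homEquiv (ModuleCat.of ℂ ℂ) G).trans ModuleCat.homEquiv).trans
      (LinearMap.ringLmapEquivSelf ℂ ℂ (Sec G ⊤)).toEquiv).bijective

lemma sec_comp {G H : Shf X} (f : cst X ⟶ G) (g : G ⟶ H) :
    sec (f ≫ g) = app g (sec f) := by
  simp only [sec]
  rw [Adjunction.homEquiv_naturality_right]
  rfl

/-- Epimorphisms of sheaves are the morphisms along which sections lift locally. -/
lemma epi_iff {G H : Shf X} (g : G ⟶ H) :
    Epi g ↔ ∀ (U : Opens X) (t : Sec H U), ∀ x ∈ U, ∃ (V : Opens X) (h : V ≤ U),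
      x ∈ V ∧ ∃ s : Sec G V, app g s = res H h t := by
  rw [← show _ ↔ Epi g from TopCat.Sheaf.isLocallySurjective_iff_epi g,
    TopCat.Presheaf.isLocallySurjective_iff]
  constructor
  · intro H U t x hx
    obtain ⟨V, h, ⟨s, hs⟩, hxV⟩ := H U t x hx
    exact ⟨V, h, hxV, s, hs⟩
  · intro H U t x hx
    obtain ⟨V, h, hxV, s, hs⟩ := H U t x hx
    exact ⟨V, h, ⟨s, hs⟩, hxV⟩

lemma mono_of_app_injective {G H : Shf X} (g : G ⟶ H)
    (hg : ∀ U : Opens X, Function.Injective (app g (U := U))) : Mono g := by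
  have : ∀ U, Mono (g.hom.app U) := fun U => (ModuleCat.mono_iff_injective _).2 (hg U.unop)
  have : Mono g.hom := NatTrans.mono_of_mono_app _
  exact Sheaf.Hom.mono_of_presheaf_mono _ _ g

lemma app_injective {G H : Shf X} (g : G ⟶ H) [Mono g] (U : Opens X) :
    Function.Injective (app g (U := U)) := by
  have : Mono ((sheafToPresheaf _ _).map g) := inferInstance
  have : Mono (((sheafToPresheaf _ _).map g).app (.op U)) := inferInstance
  exact (ModuleCat.mono_iff_injective _).1 this

/-- Taking sections over an open set is left exact. -/
lemma exact_app {S : ShortComplex (Shf X)} (hS : S.ShortExact) {U : Opens X} (t : Sec S.X₂ U)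
    (ht : app S.g t = 0) : ∃ s : Sec S.X₁ U, app S.f s = t := by
  have := hS.mono_f
  let F := sheafToPresheaf (Opens.grothendieckTopology X) (ModuleCat.{0} ℂ) ⋙
    (evaluation _ _).obj (.op U)
  have h1 : (S.map F).Exact := hS.exact.map_of_mono_of_preservesKernel F inferInstance inferInstance
  exact (ShortComplex.moduleCat_exact_iff _).1 h1 t ht

lemma shortExact_of_app {S : ShortComplex (Shf X)}
    (hf : ∀ U : Opens X, Function.Injective (app S.f (U := U)))
    (h : ∀ (U : Opens X) (t : Sec S.X₂ U), app S.g t = 0 → ∃ s : Sec S.X₁ U, app S.f s = t)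
    (hg : Epi S.g) : S.ShortExact := by
  have := mono_of_app_injective S.f hf
  refine { exact := ?_ }
  rw [ShortComplex.exact_iff_epi_kernel_lift, epi_iff]
  intro U t x hx
  obtain ⟨s, hs⟩ := h U (app (Limits.kernel.ι S.g) t) (by
    rw [← app_comp, Limits.kernel.condition]; rfl)
  refine ⟨U, le_rfl, hx, s, app_injective (Limits.kernel.ι S.g) U ?_⟩
  rw [← app_comp, Limits.kernel.lift_ι, hs, res_self]

end Sheaves

/-! ### Comparison of Ext groups under exact functors -/

section Delta

open Abelian

variable {C D : Type*} [Category C] [Category D] [Abelian C] [Abelian D] [HasExt.{0} C]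
  [HasExt.{0} D] [EnoughInjectives C]

attribute [local instance] Ext.subsingleton_of_injective in
/-- Dimension shifting: a morphism of `δ`-functors `Extⁿ(A, -) ⟶ Extⁿ(A', F -)`, with `F` exact
and preserving injective objects, is bijective in every degree if it is so in degree zero. -/
lemma bijective_of_delta (F : C ⥤ D) [F.Additive] [Limits.PreservesFiniteLimits F]
    [Limits.PreservesFiniteColimits F] [F.PreservesInjectiveObjects] (A : C) (A' : D)
    (φ : ∀ (G : C) (n : ℕ), Ext A G n →+ Ext A' (F.obj G) n)
    (hnat : ∀ {G H : C} (g : G ⟶ H) (n : ℕ) (x : Ext A G n),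
      φ H n (x.comp (Ext.mk₀ g) (add_zero n)) = (φ G n x).comp (Ext.mk₀ (F.map g)) (add_zero n))
    (hδ : ∀ {S : ShortComplex C} (hS : S.ShortExact) (n : ℕ) (x : Ext A S.X₃ n),
      φ S.X₁ (n + 1) (x.comp hS.extClass rfl) =
        (φ S.X₃ n x).comp (hS.map_of_exact F).extClass rfl)
    (h0 : ∀ G, Function.Bijective (φ G 0)) (n : ℕ) (G : C) : Function.Bijective (φ G n) := by
  induction n generalizing G with
  | zero => exact h0 G
  | succ n hn =>
    let I : InjectivePresentation G := Classical.arbitrary _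
    let S := ShortComplex.mk _ _ (Limits.cokernel.condition I.f)
    have : Injective S.X₂ := I.injective
    have : Injective (S.map F).X₂ := Functor.PreservesInjectiveObjects.injective_obj I.injective
    have hS : S.ShortExact := { exact := ShortComplex.exact_cokernel I.f }
    exact AddMonoidHom.bijective_of_surjective_of_bijective_of_right_exact _ _ _ _
      (φ S.X₂ n) (φ S.X₃ n) (φ S.X₁ (n + 1))
      (by ext x; exact (hnat S.g n x).symm) (by ext x; exact (hδ hS n x).symm)
      ((ShortComplex.ab_exact_iff_function_exact _).mp
        (Ext.covariant_sequence_exact₃' A hS n (n + 1) rfl))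
      ((ShortComplex.ab_exact_iff_function_exact _).mp
        (Ext.covariant_sequence_exact₃' A' (hS.map_of_exact F) n (n + 1) rfl))
      (hn _).surjective (hn _)
      (fun x₁ ↦ Ext.covariant_sequence_exact₁ _ hS x₁ (by subsingleton) rfl)
      (fun y₁ ↦ Ext.covariant_sequence_exact₁ _ (hS.map_of_exact F) y₁ (by subsingleton) rfl)

/-- The map on `Ext` induced by exact functors `E`, `F`, a natural transformation `E ⟶ F` and a
morphism `A' ⟶ E A`. -/
def extTransfer (E F : C ⥤ D) [E.Additive] [Limits.PreservesFiniteLimits E]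
    [Limits.PreservesFiniteColimits E] (η : E ⟶ F) {A : C} {A' : D} (u : A' ⟶ E.obj A)
    (G : C) (n : ℕ) : Ext A G n →+ Ext A' (F.obj G) n where
  toFun x :=
    (Ext.mk₀ u).comp ((x.mapExactFunctor E).comp (Ext.mk₀ (η.app G)) (add_zero n))
    (zero_add n)
  map_zero' := by simp
  map_add' := by simp

omit [EnoughInjectives C] in
lemma extTransfer_apply (E F : C ⥤ D) [E.Additive] [Limits.PreservesFiniteLimits E]
    [Limits.PreservesFiniteColimits E] (η : E ⟶ F) {A : C} {A' : D} (u : A' ⟶ E.obj A)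
    (G : C) (n : ℕ) (x : Ext A G n) : extTransfer E F η u G n x =
      (Ext.mk₀ u).comp ((x.mapExactFunctor E).comp (Ext.mk₀ (η.app G)) (add_zero n))
        (zero_add n) := rfl

/-- If `f ↦ u ≫ E f ≫ η` is a bijection from `Hom(A, G)` to `Hom(A', F G)` for all `G`, then the
induced maps on `Ext` are bijective in all degrees. -/
lemma extTransfer_bijective (E F : C ⥤ D) [E.Additive] [Limits.PreservesFiniteLimits E]
    [Limits.PreservesFiniteColimits E] [F.Additive] [Limits.PreservesFiniteLimits F]
    [Limits.PreservesFiniteColimits F] [F.PreservesInjectiveObjects] (η : E ⟶ F) {A : C} {A' : D}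
    (u : A' ⟶ E.obj A)
    (h0 : ∀ G, Function.Bijective fun f : A ⟶ G => u ≫ E.map f ≫ η.app G) (n : ℕ) (G : C) :
    Function.Bijective (extTransfer E F η u G n) := by
  refine bijective_of_delta F A A' (fun G n => extTransfer E F η u G n) ?_ ?_ ?_ n G
  · intro G H g n x
    simp only [extTransfer_apply, Ext.mapExactFunctor_comp, Ext.mapExactFunctor_mk₀,
      Ext.comp_assoc_of_third_deg_zero, Ext.mk₀_comp_mk₀, NatTrans.naturality]
  · intro S hS n x
    obtain ⟨e', he'⟩ : ∃ e' : Ext (F.obj S.X₃) (F.obj S.X₁) 1,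
      e' = (hS.map_of_exact F).extClass := ⟨_, rfl⟩
    have key : (hS.extClass.mapExactFunctor E).comp (Ext.mk₀ (η.app S.X₁)) (add_zero 1) =
        (Ext.mk₀ (η.app S.X₃)).comp e' (zero_add 1) := by
      rw [Ext.mapExactFunctor_extClass, he']
      exact ShortComplex.ShortExact.extClass_naturality (hS.map_of_exact E)
        (hS.map_of_exact F) (S.mapNatTrans η)
    change _ = (extTransfer E F η u S.X₃ n x).comp (hS.map_of_exact F).extClass _
    rw [extTransfer_apply, extTransfer_apply, Ext.mapExactFunctor_comp]
    refine Eq.trans ?_ (congrArg (fun z => Ext.comp _ z rfl) he')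
    rw [Ext.comp_assoc_of_third_deg_zero, key]
    refine ((Ext.comp_assoc (a₂₃ := n + 1) _ _ _ (zero_add n) rfl (by omega)).trans ?_).symm
    rw [Ext.comp_assoc_of_second_deg_zero]
  · intro G
    have : ⇑(extTransfer E F η u G 0) =
        Ext.mk₀ ∘ (fun f : A ⟶ G => u ≫ E.map f ≫ η.app G) ∘ Ext.homEquiv₀ := by
      ext x
      obtain ⟨f, rfl⟩ := (Ext.mk₀_bijective A G).2 x
      simp [extTransfer_apply, Ext.mapExactFunctor_mk₀, Ext.homEquiv₀]
    rw [this]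
    exact (Ext.mk₀_bijective _ _).comp ((h0 G).comp Ext.homEquiv₀.bijective)

end Delta

/-! ### Consequences of the long exact sequence -/

section LongExact

open Abelian

variable {C : Type*} [Category C] [Abelian C] [Linear ℂ C] [HasExt.{0} C]

/-- Postcomposition with a class in `Ext` as a linear map. -/
def extPostcomp (A : C) {G H : C} {p : ℕ} (β : Ext G H p) (n m : ℕ) (h : n + p = m) :
    Ext A G n →ₗ[ℂ] Ext A H m :=
  (Ext.bilinearCompOfLinear ℂ A G H n p m h).flip β

variable {S : ShortComplex C} (hS : S.ShortExact) (A : C)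

include hS in
lemma ext_equiv_of_subsingleton₁ (h : ∀ n, Subsingleton (Ext A S.X₁ n)) (n : ℕ) :
    Nonempty (Ext A S.X₂ n ≃ₗ[ℂ] Ext A S.X₃ n) := by
  refine ⟨LinearEquiv.ofBijective (extPostcomp A (Ext.mk₀ S.g) n n (add_zero n)) ⟨?_, ?_⟩⟩
  · rw [← LinearMap.ker_eq_bot, LinearMap.ker_eq_bot']
    intro x hx
    obtain ⟨y, rfl⟩ := Ext.covariant_sequence_exact₂ A hS x hx
    rw [Subsingleton.elim y 0, Ext.zero_comp]
  · intro x
    obtain ⟨y, hy⟩ := Ext.covariant_sequence_exact₃ A hS x rfl (Subsingleton.elim _ _)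
    exact ⟨y, hy⟩

include hS in
lemma ext_equiv_of_subsingleton₃ (h : ∀ n, Subsingleton (Ext A S.X₃ n)) (n : ℕ) :
    Nonempty (Ext A S.X₁ n ≃ₗ[ℂ] Ext A S.X₂ n) := by
  have := hS.mono_f
  refine ⟨LinearEquiv.ofBijective (extPostcomp A (Ext.mk₀ S.f) n n (add_zero n)) ⟨?_, ?_⟩⟩
  · rw [← LinearMap.ker_eq_bot, LinearMap.ker_eq_bot']
    intro x hx
    cases n with
    | zero =>
      exact Ext.postcomp_mk₀_injective_of_mono A S.f
        (Eq.trans hx (map_zero ((Ext.mk₀ S.f).postcomp A (add_zero 0))).symm)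
    | succ n =>
      obtain ⟨y, rfl⟩ := Ext.covariant_sequence_exact₁ A hS x hx rfl
      rw [Subsingleton.elim y 0, Ext.zero_comp]
  · intro x
    obtain ⟨y, hy⟩ := Ext.covariant_sequence_exact₂ A hS x (Subsingleton.elim _ _)
    exact ⟨y, hy⟩

include hS in
lemma ext_equiv_of_subsingleton₂ (h : ∀ n, Subsingleton (Ext A S.X₂ n)) (n : ℕ) :
    Nonempty (Ext A S.X₃ n ≃ₗ[ℂ] Ext A S.X₁ (n + 1)) := by
  refine ⟨LinearEquiv.ofBijective (extPostcomp A hS.extClass n (n + 1) rfl) ⟨?_, ?_⟩⟩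
  · rw [← LinearMap.ker_eq_bot, LinearMap.ker_eq_bot']
    intro x hx
    obtain ⟨y, rfl⟩ := Ext.covariant_sequence_exact₃ A hS x rfl hx
    rw [Subsingleton.elim y 0, Ext.zero_comp]
  · intro x
    obtain ⟨y, hy⟩ := Ext.covariant_sequence_exact₁ A hS x (Subsingleton.elim _ _) rfl
    exact ⟨y, hy⟩

omit [Linear ℂ C] in
include hS in
lemma ext_zero_subsingleton_of_subsingleton₂ (h : Subsingleton (Ext A S.X₂ 0)) :
    Subsingleton (Ext A S.X₁ 0) :=
  have := hS.mono_f
  (Ext.postcomp_mk₀_injective_of_mono A S.f).subsingleton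

end LongExact

/-! ### Cohomology of pushforwards along closed embeddings -/

section ClosedEmbedding

variable {X Y : TopCat.{0}}

/-- Pushforward along a closed embedding preserves epimorphisms: sections lift near the points of
the image, and away from the image the pushforward is zero. -/
lemma push_map_epi {f : X ⟶ Y} (hf : Topology.IsClosedEmbedding f) {G H : Shf X} (g : G ⟶ H)
    [hg : Epi g] : Epi ((push f).map g) := by
  rw [epi_iff] at hg ⊢
  intro U t y hy
  by_cases hyf : y ∈ Set.range f
  · obtain ⟨x, rfl⟩ := hyf
    obtain ⟨V, hV, hxV, s, hs⟩ := hg ((Opens.map f).obj U) t x hy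
    obtain ⟨W, hW, hWV⟩ := hf.isInducing.isOpen_iff.1 V.isOpen
    have hle : (Opens.map f).obj (⟨W, hW⟩ ⊓ U) ≤ V := by
      intro z hz
      have : z ∈ f ⁻¹' W := hz.1
      rw [hWV] at this
      exact this
    have hxW : x ∈ f ⁻¹' W := by rw [hWV]; exact hxV
    refine ⟨⟨W, hW⟩ ⊓ U, inf_le_right, ⟨hxW, hy⟩, res G hle s, ?_⟩
    change app g (res G hle s) = _
    rw [app_res, hs]
    exact res_res H hV hle t
  · let W : Opens Y := ⟨(Set.range f)ᶜ, hf.isClosed_range.isOpen_compl⟩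
    have hbot : (Opens.map f).obj (W ⊓ U) = ⊥ := by
      ext z
      simp [W]
    refine ⟨W ⊓ U, inf_le_right, ⟨hyf, hy⟩, 0, ?_⟩
    have hsub : Subsingleton (Sec ((push f).obj H) (W ⊓ U)) := by
      change Subsingleton (Sec H ((Opens.map f).obj (W ⊓ U)))
      rw [hbot]
      have := (H.isTerminalOfBotCover ⊥
        (fun _ h => h.elim))
      exact ModuleCat.subsingleton_of_isZero
        ((Limits.isZero_zero _).of_iso (this.uniqueUpToIso (Limits.isZero_zero _).isTerminal))
    exact Subsingleton.elim _ _

lemma push_preservesFiniteColimits {f : X ⟶ Y} (hf : Topology.IsClosedEmbedding f) :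
    Limits.PreservesFiniteColimits (push f) := by
  refine (((push f).exact_tfae.out 0 3 rfl rfl).1 ?_).2
  intro S hS
  have := hS.mono_f
  have := hS.epi_g
  have h1 := hS.exact.map_of_mono_of_preservesKernel (push f) inferInstance inferInstance
  have : Mono (S.map (push f)).f := inferInstanceAs (Mono ((push f).map S.f))
  have : Epi (S.map (push f)).g := push_map_epi hf S.g
  exact { exact := h1 }

/-- Sheaf cohomology is unchanged by pushforward along a closed embedding. -/
lemma ext_push_equiv {f : X ⟶ Y} (hf : Topology.IsClosedEmbedding f) (G : Shf X) (n : ℕ) :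
    Nonempty (Abelian.Ext.{0} (cst X) G n ≃ₗ[ℂ] Abelian.Ext.{0} (cst Y) ((push f).obj G) n) := by
  have := push_preservesFiniteColimits hf
  obtain ⟨u, hu⟩ := (sec_bijective ((push f).obj (cst X))).2 (sec (X := X) (G := cst X) (𝟙 _))
  let L : Abelian.Ext.{0} (cst X) G n →ₗ[ℂ] Abelian.Ext.{0} (cst Y) ((push f).obj G) n :=
    (Abelian.Ext.bilinearCompOfLinear ℂ _ _ _ 0 n n (zero_add n) (Abelian.Ext.mk₀ u)) ∘ₗ
      (push f).mapExtLinearMap ℂ (cst X) G n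
  have hL : ⇑L = extTransfer (push f) (push f) (𝟙 _) u G n := by
    ext1 x
    simp only [extTransfer_apply, NatTrans.id_app, Abelian.Ext.comp_mk₀_id]
    rfl
  refine ⟨LinearEquiv.ofBijective L ?_⟩
  rw [hL]
  refine extTransfer_bijective _ _ _ _ (fun G => ?_) n G
  have : (sec (G := (push f).obj G)) ∘ (fun g : cst X ⟶ G => u ≫ (push f).map g ≫
      (𝟙 (push f) : push f ⟶ push f).app G) = sec (G := G) := by
    ext1 g
    simp only [Function.comp, NatTrans.id_app, Category.comp_id]
    rw [sec_comp, hu]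
    change app g (sec (X := X) (G := cst X) (𝟙 _)) = _
    rw [← sec_comp, Category.id_comp]
  exact (Function.Bijective.of_comp_iff' (sec_bijective _) _).1 (this ▸ sec_bijective G)

end ClosedEmbedding

/-! ### The sequence of a closed subspace -/

section ConcreteSheaves

variable {X Z : Type} [TopologicalSpace X] [TopologicalSpace Z]

/-- Composition with `f`, as a morphism `extByZero D ⟶ f_* extByZero D'` for `f(D') ⊆ D`. -/
def homOfSections {D : Set X} {D' : Set Z} (f : C(Z, X))
    (h : ∀ z ∈ D', f z ∈ D) :
    extByZero D ⟶ (push (TopCat.ofHom f)).obj (extByZero D') where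
  hom :=
    { app V := ModuleCat.ofHom
        { toFun g := ⟨fun z => g.1 ⟨f z.1, z.2⟩, g.2.1.comp_continuous
              (f := fun z : ((Opens.map (TopCat.ofHom f)).obj V.unop) =>
                (⟨f z.1, z.2⟩ : V.unop)) (by fun_prop),
            fun z hz => g.2.2 ⟨f z.1, z.2⟩ (h z hz)⟩
          map_add' _ _ := rfl
          map_smul' _ _ := rfl }
      naturality _ _ _ := rfl }

/-- The inclusion `extByZero D' ⟶ extByZero D` for `D ⊆ D'`. -/
def inclusion {D D' : Set X} (h : D ⊆ D') : extByZero D' ⟶ extByZero D where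
  hom :=
    { app _ := ModuleCat.ofHom
        { toFun g := ⟨g.1, g.2.1, fun x hx => g.2.2 x (h hx)⟩
          map_add' _ _ := rfl
          map_smul' _ _ := rfl }
      naturality _ _ _ := rfl }

/-- The short exact sequence of a closed embedding `f : Z → X`, which restricts the functions that
vanish on `D` to `Z`. -/
lemma shortExact_extByZero {D : Set X} (hD : IsClosed D) (f : C(Z, X))
    (hf : Topology.IsClosedEmbedding f) :
    (ShortComplex.mk (inclusion (Set.subset_union_left (s := D) (t := Set.range f)))
      (homOfSections (D' := f ⁻¹' D) f (fun _ hz => hz)) (by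
        ext V g
        apply Subtype.ext
        funext z
        exact g.2.2 ⟨f z.1, z.2⟩ (Or.inr ⟨z.1, rfl⟩))).ShortExact := by
  refine shortExact_of_app (fun U => ?_) (fun U t ht => ?_) ?_
  · intro g g' h
    exact Subtype.ext (congrArg Subtype.val h :)
  · have ht' : ∀ z (hz : f z ∈ U), t.1 ⟨f z, hz⟩ = 0 := fun z hz =>
      congrFun (congrArg Subtype.val ht :) ⟨z, hz⟩
    refine ⟨⟨t.1, t.2.1, ?_⟩, rfl⟩
    rintro ⟨x, hx⟩ (h | ⟨z, rfl⟩)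
    · exact t.2.2 ⟨x, hx⟩ h
    · exact ht' z hx
  · rw [epi_iff]
    intro U t x hx
    -- It is enough to find a neighborhood on which `t` is constant.
    have aux : ∀ (V : Opens X) (hV : V ≤ U) (c : ℂ), (∀ y ∈ V, y ∈ D → c = 0) → x ∈ V →
        (∀ z (hz : f z ∈ V), t.1 ⟨z, hV hz⟩ = c) → ∃ (V : Opens X) (h : V ≤ U),
      x ∈ V ∧ ∃ s : Sec (extByZero D) V, app (homOfSections (D' := f ⁻¹' D) f (fun _ hz => hz)) s =
        res ((push (TopCat.ofHom f)).obj (extByZero (f ⁻¹' D))) h t := by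
      intro V hV c hc hxV h
      refine ⟨V, hV, hxV, ⟨fun _ => c, IsLocallyConstant.const c, fun y hy => hc y y.2 hy⟩, ?_⟩
      apply Subtype.ext
      funext z
      exact (h z.1 z.2).symm
    by_cases hxf : x ∈ Set.range f
    · obtain ⟨z, rfl⟩ := hxf
      obtain ⟨O, hO, hzO, hOc⟩ := t.2.1.exists_open ⟨z, hx⟩
      obtain ⟨W, hW, hWO⟩ : ∃ W : Set X, IsOpen W ∧ ∀ z' (h : f z' ∈ U),
          f z' ∈ W ↔ (⟨z', h⟩ : (Opens.map (TopCat.ofHom f)).obj U) ∈ O := by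
        obtain ⟨O', hO', rfl⟩ := isOpen_induced_iff.1 hO
        obtain ⟨W, hW, rfl⟩ := hf.isInducing.isOpen_iff.1 hO'
        exact ⟨W, hW, fun z' h => Iff.rfl⟩
      by_cases hzD : f z ∈ D
      · refine aux (⟨W, hW⟩ ⊓ U) inf_le_right 0 (fun _ _ _ => rfl)
          ⟨(hWO z hx).2 hzO, hx⟩ (fun z' hz' => ?_)
        have h1 := hOc ⟨z', hz'.2⟩ ((hWO z' hz'.2).1 hz'.1)
        exact h1.trans (t.2.2 ⟨z, hx⟩ hzD)
      · refine aux (⟨W, hW⟩ ⊓ U ⊓ ⟨Dᶜ, hD.isOpen_compl⟩) (inf_le_left.trans inf_le_right)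
          (t.1 ⟨z, hx⟩) (fun y hy hyD => (hy.2 hyD).elim)
          ⟨⟨(hWO z hx).2 hzO, hx⟩, hzD⟩ (fun z' hz' => ?_)
        exact hOc ⟨z', hz'.1.2⟩ ((hWO z' hz'.1.2).1 hz'.1.1)
    · exact aux (⟨(Set.range f)ᶜ, hf.isClosed_range.isOpen_compl⟩ ⊓ U) inf_le_right 0
        (fun _ _ _ => rfl) ⟨hxf, hx⟩ (fun z hz => (hz.1 ⟨z, rfl⟩).elim)

end ConcreteSheaves

/-! ### Relative cohomology and closed subspaces -/

section Relative

variable {X Z : Type} [TopologicalSpace X] [TopologicalSpace Z]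

/-- `H^•(X, D) = 0`. -/
def Acyclic (X : Type) [TopologicalSpace X] (D : Set X) : Prop :=
  ∀ k, Subsingleton (RelCohomology X D k)

lemma relCohomology_push_equiv (f : C(Z, X)) (hf : Topology.IsClosedEmbedding f) (D : Set Z)
    (k : ℕ) : Nonempty (RelCohomology Z D k ≃ₗ[ℂ]
      SheafCohomology X ((push (TopCat.ofHom f)).obj (extByZero D)) k) :=
  ext_push_equiv (f := TopCat.ofHom f) hf (extByZero D) k

lemma acyclic_push {f : C(Z, X)} (hf : Topology.IsClosedEmbedding f) {D : Set Z}
    (h : Acyclic Z D) (k : ℕ) :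
    Subsingleton (SheafCohomology X ((push (TopCat.ofHom f)).obj (extByZero D)) k) := by
  obtain ⟨e⟩ := relCohomology_push_equiv f hf D k
  have := h k
  exact e.symm.injective.subsingleton

/-- If `X` has no cohomology relative to the union of `D` and a closed subspace, then cohomology
relative to `D` can be computed on that subspace. -/
lemma restrict_equiv {D : Set X} (hD : IsClosed D) {f : C(Z, X)}
    (hf : Topology.IsClosedEmbedding f) (h : Acyclic X (D ∪ Set.range f)) (k : ℕ) :
    Nonempty (RelCohomology X D k ≃ₗ[ℂ] RelCohomology Z (f ⁻¹' D) k) := by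
  obtain ⟨e⟩ := ext_equiv_of_subsingleton₁ (shortExact_extByZero hD f hf) (constSheaf X) h k
  obtain ⟨e'⟩ := relCohomology_push_equiv f hf (f ⁻¹' D) k
  exact ⟨e.trans e'.symm⟩

/-- The subset `D` can be enlarged by a closed subspace that has no cohomology relative to `D`. -/
lemma enlarge_equiv {D : Set X} (hD : IsClosed D) {f : C(Z, X)}
    (hf : Topology.IsClosedEmbedding f) (h : Acyclic Z (f ⁻¹' D)) (k : ℕ) :
    Nonempty (RelCohomology X (D ∪ Set.range f) k ≃ₗ[ℂ] RelCohomology X D k) :=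
  ext_equiv_of_subsingleton₃ (shortExact_extByZero hD f hf) (constSheaf X)
    (acyclic_push hf h) k

/-- If `(X, D)` is acyclic, the boundary map of the triple `D ⊆ D ∪ f(Z) ⊆ X` is an isomorphism. -/
lemma boundary_equiv {D : Set X} (hD : IsClosed D) {f : C(Z, X)}
    (hf : Topology.IsClosedEmbedding f) (h : Acyclic X D) (k : ℕ) :
    Nonempty (RelCohomology Z (f ⁻¹' D) k ≃ₗ[ℂ] RelCohomology X (D ∪ Set.range f) (k + 1)) := by
  obtain ⟨e⟩ := ext_equiv_of_subsingleton₂ (shortExact_extByZero hD f hf) (constSheaf X) h k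
  obtain ⟨e'⟩ := relCohomology_push_equiv f hf (f ⁻¹' D) k
  exact ⟨e'.trans e⟩

lemma relCohomology_zero_subsingleton {D : Set X} (hD : IsClosed D) {f : C(Z, X)}
    (hf : Topology.IsClosedEmbedding f) (h : Acyclic X D) :
    Subsingleton (RelCohomology X (D ∪ Set.range f) 0) :=
  ext_zero_subsingleton_of_subsingleton₂ (shortExact_extByZero hD f hf) (constSheaf X) (h 0)

lemma acyclic_univ : Acyclic X Set.univ := by
  intro k
  have h0 : (𝟙 (extByZero (Set.univ : Set X))) = 0 := by
    ext V g
    apply Subtype.ext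
    funext x
    exact g.2.2 x trivial
  refine ⟨fun x y => ?_⟩
  rw [← Abelian.Ext.comp_mk₀_id x, ← Abelian.Ext.comp_mk₀_id y, h0]
  simp

lemma relCohomology_homeomorph (e : Z ≃ₜ X) {D : Set X} (hD : IsClosed D) (k : ℕ) :
    Nonempty (RelCohomology X D k ≃ₗ[ℂ] RelCohomology Z (e ⁻¹' D) k) := by
  refine restrict_equiv (f := ⟨e, e.continuous⟩) hD e.isClosedEmbedding ?_ k
  have : D ∪ Set.range (⟨e, e.continuous⟩ : C(Z, X)) = Set.univ :=
    Set.eq_univ_of_forall fun x => Or.inr (e.surjective x)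
  rw [this]
  exact acyclic_univ

end Relative

/-! ### Gluing and extension of sections -/

section Gluing

variable {X : TopCat.{0}}

lemma res_add (G : Shf X) {U V : Opens X} (h : V ≤ U) (s t : Sec G U) :
    res G h (s + t) = res G h s + res G h t := map_add _ _ _

lemma res_sub (G : Shf X) {U V : Opens X} (h : V ≤ U) (s t : Sec G U) :
    res G h (s - t) = res G h s - res G h t := map_sub _ _ _

lemma exists_glue (G : Shf X) {U V : Opens X} (s : Sec G U) (t : Sec G V)
    (h : res G (inf_le_left : U ⊓ V ≤ U) s = res G (inf_le_right : U ⊓ V ≤ V) t) :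
    ∃ w : Sec G (U ⊔ V), res G le_sup_left w = s ∧ res G le_sup_right w = t := by
  let f : Bool → Opens X := fun b => if b then U else V
  let sf : ∀ b, Sec G (f b) := fun b => match b with
    | true => s
    | false => t
  obtain ⟨w, hw, -⟩ := TopCat.Sheaf.existsUnique_gluing' G f (U ⊔ V)
    (fun b => homOfLE (by cases b <;> simp [f]))
    (by rw [sup_le_iff]; exact ⟨le_iSup f true, le_iSup f false⟩) sf (by
      rintro (_ | _) (_ | _)
      · rfl
      · have := congrArg (res G (inf_comm V U).le) h
        rw [res_res, res_res] at this
        exact this.symm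
      · exact h
      · rfl)
  exact ⟨w, hw true, hw false⟩

lemma sec_ext_sup (G : Shf X) {U V : Opens X} (s t : Sec G (U ⊔ V))
    (h₁ : res G le_sup_left s = res G le_sup_left t)
    (h₂ : res G le_sup_right s = res G le_sup_right t) : s = t := by
  let f : Bool → Opens X := fun b => if b then U else V
  refine TopCat.Sheaf.eq_of_locally_eq' G f (U ⊔ V)
    (fun b => homOfLE (by cases b <;> simp [f]))
    (by rw [sup_le_iff]; exact ⟨le_iSup f true, le_iSup f false⟩) s t ?_
  rintro (_ | _)
  · exact h₂
  · exact h₁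

/-- Injective sheaves are flasque. -/
lemma exists_extension_of_injective (J : Shf X) [Injective J] {U : Opens X} (s : Sec J U) :
    ∃ t : Sec J ⊤, res J le_top t = s := by
  let A := ((ModuleCat.adj ℂ).whiskerRight (Opens X)ᵒᵖ).comp
    (sheafificationAdjunction (Opens.grothendieckTopology X) (ModuleCat.{0} ℂ))
  let i : U ⟶ (⊤ : Opens X) := homOfLE le_top
  have : Mono (((Functor.whiskeringRight (Opens X)ᵒᵖ _ _).obj (ModuleCat.free ℂ)).map
      (yoneda.map i)) := by
    have : ∀ V, Mono ((((Functor.whiskeringRight (Opens X)ᵒᵖ _ _).obj (ModuleCat.free ℂ)).map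
        (yoneda.map i)).app V) := fun V => by
      rw [ModuleCat.mono_iff_injective]
      exact Finsupp.mapDomain_injective (fun a b _ => Subsingleton.elim (α := V.unop ⟶ U) a b)
    exact NatTrans.mono_of_mono_app _
  let m := (presheafToSheaf (Opens.grothendieckTopology X) (ModuleCat.{0} ℂ)).map
    (((Functor.whiskeringRight (Opens X)ᵒᵖ _ _).obj (ModuleCat.free ℂ)).map (yoneda.map i))
  have : Mono m := inferInstance
  let φ := (A.homEquiv (yoneda.obj U) J).symm (yonedaEquiv.symm s)
  let ψ := Injective.factorThru φ m
  have hψ : m ≫ ψ = φ := Injective.comp_factorThru φ m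
  refine ⟨yonedaEquiv (A.homEquiv (yoneda.obj ⊤) J ψ), ?_⟩
  have h1 : yoneda.map i ≫ A.homEquiv _ J ψ = yonedaEquiv.symm s := by
    rw [← Adjunction.homEquiv_naturality_left]
    change A.homEquiv _ J (m ≫ ψ) = _
    rw [hψ, Equiv.apply_symm_apply]
  have h2 := congrArg yonedaEquiv h1
  rw [Equiv.apply_symm_apply, ← yonedaEquiv_naturality] at h2
  exact h2

end Gluing

/-! ### Cohomology of cylinders -/

section Cylinder

variable {X : Type} [TopologicalSpace X]

/-- The cylinder `X × [0, 1]`. -/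
abbrev Cyl (X : Type) [TopologicalSpace X] : TopCat.{0} := TopCat.of (X × unitInterval)

/-- The projection of the cylinder to its base. -/
abbrev cylProj (X : Type) [TopologicalSpace X] : Cyl X ⟶ TopCat.of X :=
  TopCat.ofHom ⟨Prod.fst, continuous_fst⟩

/-- A sheaf on the cylinder is right extendable if every germ at a point `(x, c)` extends to a
neighbourhood of `{x} × [c, 1]`. -/
def RightExtendable (G : Shf (Cyl X)) : Prop :=
  ∀ (x : X) (c : unitInterval) (W : Opens (Cyl X)) (_ : (x, c) ∈ W) (s : Sec G W),
    ∃ (W' V : Opens (Cyl X)) (hV : V ≤ W) (hV' : V ≤ W'), (x, c) ∈ V ∧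
      (∀ u, c ≤ u → (x, u) ∈ W') ∧ ∃ t : Sec G W', res G hV' t = res G hV s

/-- The points of the cylinder of height less than `c`. -/
def below (X : Type) [TopologicalSpace X] (c : unitInterval) : Opens (Cyl X) :=
  ⟨{p | p.2 < c}, isOpen_lt continuous_snd continuous_const⟩

/-- The points of the cylinder of height greater than `c`. -/
def above (X : Type) [TopologicalSpace X] (c : unitInterval) : Opens (Cyl X) :=
  ⟨{p | c < p.2}, isOpen_lt continuous_const continuous_snd⟩

/-- A lift near `{x} × [0, c]` and one near `{x} × [c, c']` can be glued to a lift near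
`{x} × [0, c']`: near `(x, c)` they differ by a section of `S.X₁`, which extends to the right and is
used to correct the second lift. -/
lemma lift_step {S : ShortComplex (Shf (Cyl X))} (hS : S.ShortExact)
    (hG : RightExtendable S.X₁) {W₀ : Opens (Cyl X)} (σ : Sec S.X₃ W₀) (x : X)
    {c c' : unitInterval} (hc : c ≤ c') {W₁ W₂ : Opens (Cyl X)} (hW₁ : W₁ ≤ W₀) (hW₂ : W₂ ≤ W₀)
    (h₁ : ∀ u, u ≤ c → (x, u) ∈ W₁) (h₂ : ∀ u, c ≤ u → u ≤ c' → (x, u) ∈ W₂)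
    (τ₁ : Sec S.X₂ W₁) (hτ₁ : app S.g τ₁ = res S.X₃ hW₁ σ)
    (τ₂ : Sec S.X₂ W₂) (hτ₂ : app S.g τ₂ = res S.X₃ hW₂ σ) :
    ∃ (W : Opens (Cyl X)) (hW : W ≤ W₀), (∀ u, u ≤ c' → (x, u) ∈ W) ∧
      ∃ τ : Sec S.X₂ W, app S.g τ = res S.X₃ hW σ := by
  have hmem₁ : (x, c) ∈ W₁ := h₁ c le_rfl
  have hmem₂ : (x, c) ∈ W₂ := h₂ c le_rfl hc
  obtain ⟨g, hg⟩ := exact_app hS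
    (res S.X₂ (inf_le_left : W₁ ⊓ W₂ ≤ W₁) τ₁ - res S.X₂ (inf_le_right : W₁ ⊓ W₂ ≤ W₂) τ₂) (by
      simp only [app, map_sub]
      change app S.g _ - app S.g _ = 0
      rw [app_res, app_res, hτ₁, hτ₂, res_res, res_res, sub_self])
  obtain ⟨W', V, hV, hV', hxV, hxW', t, ht⟩ := hG x c (W₁ ⊓ W₂) ⟨hmem₁, hmem₂⟩ g
  -- The two open sets below meet inside `V`, where the corrected lifts agree.
  let A₁ : Opens (Cyl X) := W₁ ⊓ (below X c ⊔ V)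
  let A₂ : Opens (Cyl X) := (W₂ ⊓ W') ⊓ (above X c ⊔ V)
  have hA : A₁ ⊓ A₂ ≤ V := by
    rintro p ⟨⟨-, h | h⟩, ⟨-, h' | h'⟩⟩
    · exact (lt_asymm (show p.2 < c from h) h').elim
    all_goals assumption
  have hA₁ : A₁ ≤ W₁ := inf_le_left
  have hA₂ : A₂ ≤ W₂ := inf_le_left.trans inf_le_left
  have hA₂' : A₂ ≤ W' := inf_le_left.trans inf_le_right
  obtain ⟨w, hw₁, hw₂⟩ := exists_glue S.X₂ (res S.X₂ hA₁ τ₁)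
    (res S.X₂ hA₂ τ₂ + res S.X₂ hA₂' (app S.f t)) (by
      have e1 := congrArg (res S.X₂ hA) (congrArg (res S.X₂ hV) hg)
      rw [res_sub, res_sub, ← app_res, ← app_res, ← ht, app_res, app_res] at e1
      simp only [res_res] at e1
      rw [res_add]
      simp only [res_res]
      rw [e1]
      abel)
  refine ⟨A₁ ⊔ A₂, sup_le (hA₁.trans hW₁) (hA₂.trans hW₂), fun u hu => ?_, w, ?_⟩
  · rcases lt_trichotomy u c with h | rfl | h
    · exact Or.inl ⟨h₁ u h.le, Or.inl h⟩
    · exact Or.inl ⟨hmem₁, Or.inr hxV⟩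
    · exact Or.inr ⟨⟨h₂ u h.le hu, hxW' u h.le⟩, Or.inl h⟩
  · apply sec_ext_sup
    · rw [← app_res, hw₁, app_res, hτ₁, res_res, res_res]
    · rw [← app_res, hw₂]
      have h0 : app S.g (res S.X₂ hA₂' (app S.f t)) = 0 := by
        rw [app_res, ← app_comp, S.zero]
        exact map_zero _
      simp only [app, map_add]
      change app S.g _ + app S.g _ = _
      rw [h0, add_zero, app_res, hτ₂, res_res, res_res]

/-- Sections of the quotient by a right extendable sheaf lift in a neighbourhood of each fiber of
the cylinder. -/
lemma exists_lift_near_fiber {S : ShortComplex (Shf (Cyl X))} (hS : S.ShortExact)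
    (hG : RightExtendable S.X₁) {W₀ : Opens (Cyl X)} (σ : Sec S.X₃ W₀) (x : X)
    (hx : ∀ u, (x, u) ∈ W₀) :
    ∃ (W : Opens (Cyl X)) (hW : W ≤ W₀), (∀ u, (x, u) ∈ W) ∧
      ∃ τ : Sec S.X₂ W, app S.g τ = res S.X₃ hW σ := by
  have hloc := (epi_iff S.g).1 hS.epi_g W₀ σ
  choose V hV hxV τ hτ using fun u : unitInterval => hloc (x, u) (hx u)
  obtain ⟨t, ht0, htm, ⟨N, hN⟩, ht⟩ := exists_monotone_Icc_subset_open_cover_unitInterval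
    (c := fun u => {v | (x, v) ∈ V u}) (fun u => (V u).isOpen.preimage (by fun_prop))
    (fun u _ => Set.mem_iUnion.2 ⟨u, hxV u⟩)
  have key : ∀ n, ∃ (W : Opens (Cyl X)) (hW : W ≤ W₀), (∀ u, u ≤ t n → (x, u) ∈ W) ∧
      ∃ τ : Sec S.X₂ W, app S.g τ = res S.X₃ hW σ := by
    intro n
    induction n with
    | zero =>
      refine ⟨V 0, hV 0, fun u hu => ?_, τ 0, hτ 0⟩
      rw [ht0] at hu
      rw [le_antisymm hu u.2.1]
      exact hxV 0
    | succ n ih =>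
      obtain ⟨W, hW, hxW, τ', hτ'⟩ := ih
      obtain ⟨v, hv⟩ := ht n
      exact lift_step hS hG σ x (htm (Nat.le_succ n)) hW (hV v) hxW
        (fun u h h' => hv ⟨h, h'⟩) τ' hτ' (τ v) (hτ v)
  obtain ⟨W, hW, hxW, h⟩ := key N
  exact ⟨W, hW, fun u => hxW u ((hN N le_rfl).symm ▸ u.2.2), h⟩

lemma epi_push_cylProj {S : ShortComplex (Shf (Cyl X))} (hS : S.ShortExact)
    (hG : RightExtendable S.X₁) : Epi ((push (cylProj X)).map S.g) := by
  rw [epi_iff]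
  intro U t x hx
  obtain ⟨W, hW, hxW, τ, hτ⟩ := exists_lift_near_fiber hS hG
    (W₀ := (Opens.map (cylProj X)).obj U) t x (fun u => hx)
  -- The tube lemma: the base points whose fiber lies in `W` form an open set.
  let A : Opens (TopCat.of X) := ⟨(Prod.fst '' (W : Set (X × unitInterval))ᶜ)ᶜ,
    (isClosedMap_fst_of_compactSpace _ W.isOpen.isClosed_compl).isOpen_compl⟩
  have hA : ∀ y, y ∈ A ↔ ∀ u, (y, u) ∈ W := by
    intro y
    refine ⟨fun h u => by_contra fun hu => h ⟨(y, u), hu, rfl⟩, ?_⟩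
    rintro h ⟨⟨_, u⟩, hu, rfl⟩
    exact hu (h u)
  have hAW : (Opens.map (cylProj X)).obj A ≤ W := fun p hp => (hA p.1).1 hp p.2
  refine ⟨A, fun y hy => hW ((hA y).1 hy 0), (hA x).2 hxW, res S.X₂ hAW τ, ?_⟩
  change app S.g (res S.X₂ hAW τ) = _
  rw [app_res, hτ]
  exact res_res S.X₃ hW hAW t

lemma shortExact_push_cylProj {S : ShortComplex (Shf (Cyl X))}
    (hS : S.ShortExact) (hG : RightExtendable S.X₁) : (S.map (push (cylProj X))).ShortExact := by
  have := hS.mono_f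
  have h := hS.exact.map_of_mono_of_preservesKernel (push (cylProj X)) inferInstance inferInstance
  have : Mono (S.map (push (cylProj X))).f := inferInstanceAs (Mono ((push (cylProj X)).map S.f))
  have : Epi (S.map (push (cylProj X))).g := epi_push_cylProj hS hG
  exact { exact := h }

/-- Quotients of flasque sheaves are right extendable: a germ lifts, and its lift extends
globally. -/
lemma rightExtendable_of_injective {S : ShortComplex (Shf (Cyl X))} (hS : S.ShortExact)
    [Injective S.X₂] : RightExtendable S.X₃ := by
  intro x c W hW s
  obtain ⟨V, hV, hxV, τ, hτ⟩ := (epi_iff S.g).1 hS.epi_g W s (x, c) hW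
  obtain ⟨τ', hτ'⟩ := exists_extension_of_injective S.X₂ τ
  refine ⟨⊤, V, hV, le_top, hxV, fun _ _ => trivial, app S.g τ', ?_⟩
  rw [← app_res, hτ', hτ]

open Abelian in
/-- A right extendable sheaf with injective direct image has no higher cohomology: the direct
image of an injective resolution of it stays exact and splits. -/
lemma ext_subsingleton_of_rightExtendable (n : ℕ) (G : Shf (Cyl X)) (hG : RightExtendable G)
    (hI : Injective ((push (cylProj X)).obj G)) :
    Subsingleton (Ext.{0} (cst (Cyl X)) G (n + 1)) := by
  induction n generalizing G with
  | zero =>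
    let I : InjectivePresentation G := Classical.arbitrary _
    let S := ShortComplex.mk _ _ (Limits.cokernel.condition I.f)
    have : Injective S.X₂ := I.injective
    have hS : S.ShortExact := { exact := ShortComplex.exact_cokernel I.f }
    have hS' := shortExact_push_cylProj hS hG
    have : Injective (S.map (push (cylProj X))).X₁ := hI
    let sp := hS'.splittingOfInjective
    refine ⟨fun x y => ?_⟩
    suffices h : ∀ x : Ext.{0} (cst (Cyl X)) G 1, x = 0 by rw [h x, h y]
    intro x
    obtain ⟨y, rfl⟩ := Ext.covariant_sequence_exact₁ _ hS x
      (Ext.eq_zero_of_injective _) (zero_add 1)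
    obtain ⟨y, rfl⟩ := (Ext.mk₀_bijective _ _).2 y
    -- The global section of `S.X₃` given by `y` lifts to `S.X₂` along the splitting.
    let r : (push (cylProj X)).obj S.X₃ ⟶ (push (cylProj X)).obj S.X₂ := sp.s
    have hr : r ≫ (push (cylProj X)).map S.g = 𝟙 _ := sp.s_g
    let σ : Sec ((push (cylProj X)).obj S.X₃) ⊤ := sec (G := S.X₃) y
    have hτ : app ((push (cylProj X)).map S.g) (app r σ) = σ := by
      rw [← app_comp, hr]
      rfl
    obtain ⟨z, hz⟩ := (sec_bijective S.X₂).2 (app r σ)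
    have hzy : z ≫ S.g = y := (sec_bijective S.X₃).1 (by rw [sec_comp, hz]; exact hτ)
    rw [← hzy, ← Ext.mk₀_comp_mk₀, Ext.comp_assoc_of_second_deg_zero, hS.comp_extClass,
      Ext.comp_zero]
  | succ n ih =>
    let I : InjectivePresentation G := Classical.arbitrary _
    let S := ShortComplex.mk _ _ (Limits.cokernel.condition I.f)
    have : Injective S.X₂ := I.injective
    have hS : S.ShortExact := { exact := ShortComplex.exact_cokernel I.f }
    have hS' := shortExact_push_cylProj hS hG
    have : Injective (S.map (push (cylProj X))).X₁ := hI
    let sp := hS'.splittingOfInjective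
    have hI₃ : Injective ((push (cylProj X)).obj S.X₃) := by
      have : Injective ((push (cylProj X)).obj S.X₂) :=
        injective_push (cylProj X) I.injective
      exact Retract.injective (Y := (push (cylProj X)).obj S.X₂)
        { i := sp.s, r := (push (cylProj X)).map S.g, retract := sp.s_g }
    have := ih S.X₃ (rightExtendable_of_injective hS) hI₃
    refine ⟨fun x y => ?_⟩
    suffices h : ∀ x : Ext.{0} (cst (Cyl X)) G (n + 2), x = 0 by rw [h x, h y]
    intro x
    obtain ⟨y, rfl⟩ := Ext.covariant_sequence_exact₁ _ hS x
      (Ext.eq_zero_of_injective _) (show n + 1 + 1 = n + 2 from rfl)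
    rw [Subsingleton.elim y 0, Ext.zero_comp]

end Cylinder

/-! ### Cohomology of retracts -/

section Retract

variable {X Y : TopCat.{0}} (h : Y ⟶ X) (i : X ⟶ Y) (hih : i ≫ h = 𝟙 X)

include hih in
lemma map_map_le (U : Opens X) : (Opens.map i).obj ((Opens.map h).obj U) ≤ U := by
  intro x hx
  have h1 : (i ≫ h) x ∈ U := hx
  rw [hih] at h1
  exact h1

/-- For a section `i` of `h`, the canonical map `G ⟶ h_* i_* G`. -/
def toPushPush : 𝟭 (Shf X) ⟶ push i ⋙ push h where
  app G :=
    { hom :=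
        { app U := G.obj.map (homOfLE (map_map_le h i hih U.unop)).op
          naturality _ _ _ := by
            change G.obj.map _ ≫ G.obj.map _ = G.obj.map _ ≫ G.obj.map _
            rw [← Functor.map_comp, ← Functor.map_comp]
            rfl } }
  naturality G H g := by
    ext U s
    exact (app_res g (map_map_le h i hih U.unop) s).symm

lemma app_toPushPush (G : Shf X) {U : Opens X} (s : Sec G U) :
    app ((toPushPush h i hih).app G) s = res G (map_map_le h i hih U) s := rfl

/-- For a section `i` of `h`, the canonical map `h⁻¹ ⟶ i_*`. -/
def pullToPush : pull h ⟶ push i where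
  app G := ((pullPushAdj h).homEquiv _ _).symm ((toPushPush h i hih).app G)
  naturality G H g := by
    rw [← Adjunction.homEquiv_naturality_left_symm]
    exact (congrArg ((pullPushAdj h).homEquiv _ _).symm
      ((toPushPush h i hih).naturality g)).trans
        ((pullPushAdj h).homEquiv_naturality_right_symm
          ((toPushPush h i hih).app G) ((push i).map g))

open Abelian in
/-- If `i` is a closed section of `h`, and the identity of `S` factors as `S ⟶ h_* T ⟶ h_* i_* S`,
then the cohomology of `S` is a direct summand of that of `T`, and vanishes with it. -/
lemma ext_subsingleton_of_retract (hi : Topology.IsClosedEmbedding i) {S : Shf X} {T : Shf Y}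
    (a : S ⟶ (push h).obj T) (c : T ⟶ (push i).obj S)
    (hac : a ≫ (push h).map c = (toPushPush h i hih).app S)
    (hT : ∀ n, Subsingleton (Ext.{0} (cst Y) T n)) (n : ℕ) :
    Subsingleton (Ext.{0} (cst X) S n) := by
  have := push_preservesFiniteColimits hi
  obtain ⟨u, hu⟩ := (sec_bijective ((pull h).obj (cst X))).2
    (app ((pullPushAdj h).unit.app (cst X)) (sec (X := X) (G := cst X) (𝟙 _)))
  have hbij : Function.Bijective (extTransfer (pull h) (push i) (pullToPush h i hih) u S n) := by
    refine extTransfer_bijective _ _ _ _ (fun G => ?_) n S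
    have : (sec (G := (push i).obj G)) ∘ (fun g : cst X ⟶ G => u ≫ (pull h).map g ≫
        (pullToPush h i hih).app G) = sec (G := G) := by
      ext1 g
      simp only [Function.comp]
      rw [sec_comp, hu]
      change app ((pullPushAdj h).unit.app (cst X) ≫ (push h).map ((pull h).map g ≫
        (pullToPush h i hih).app G)) (sec (X := X) (G := cst X) (𝟙 _)) = _
      have h1 : (pullPushAdj h).unit.app (cst X) ≫ (push h).map ((pull h).map g ≫
          (pullToPush h i hih).app G) = g ≫ (toPushPush h i hih).app G := by
        refine ((pullPushAdj h).homEquiv_unit ..).symm.trans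
          (((pullPushAdj h).homEquiv_naturality_left ..).trans ?_)
        simp only [pullToPush, Equiv.apply_symm_apply]
      rw [h1, app_comp, ← sec_comp, Category.id_comp, app_toPushPush]
      exact res_self G _ _
    exact (Function.Bijective.of_comp_iff' (sec_bijective _) _).1 (this ▸ sec_bijective G)
  refine ⟨fun x y => ?_⟩
  suffices hx : ∀ x, extTransfer (pull h) (push i) (pullToPush h i hih) u S n x = 0 from
    hbij.1 ((hx x).trans (hx y).symm)
  intro x
  have h2 : (pullToPush h i hih).app S = ((pullPushAdj h).homEquiv _ _).symm a ≫ c := by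
    rw [← Adjunction.homEquiv_naturality_right_symm, hac]
    rfl
  rw [extTransfer_apply, h2, ← Ext.mk₀_comp_mk₀, ← Ext.comp_assoc_of_third_deg_zero,
    ← Ext.comp_assoc_of_third_deg_zero]
  exact (congrArg (fun z => Ext.comp z (Ext.mk₀ c) _) (Subsingleton.elim _ 0)).trans
    (Ext.zero_comp ..)

end Retract

/-! ### Contractible pairs -/

section Contraction

variable {X : Type} [TopologicalSpace X]

/-- The part of the cylinder lying over `D` together with the bottom. -/
def cylSet (D : Set X) : Set (X × unitInterval) := {p | p.1 ∈ D ∨ p.2 = 0}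

/-- A germ with value zero extends by zero. A germ with nonzero value at `(x, c)` exists only for
`x ∉ D` and `c > 0`, and extends by the same constant. -/
lemma rightExtendable_extByZero {D : Set X} (hD : IsClosed D) :
    RightExtendable (extByZero (cylSet D)) := by
  intro x c W hW s
  obtain ⟨O, hO, hxO, hOc⟩ := s.2.1.exists_open ⟨(x, c), hW⟩
  let V : Opens (Cyl X) := ⟨Subtype.val '' O, W.isOpen.isOpenEmbedding_subtypeVal.isOpenMap O hO⟩
  have hV : V ≤ W := by
    rintro _ ⟨p, -, rfl⟩
    exact p.2
  have hVc : ∀ p (hp : p ∈ V), s.1 ⟨p, hV hp⟩ = s.1 ⟨(x, c), hW⟩ := by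
    rintro _ ⟨p, hp, rfl⟩
    exact hOc p hp
  have hxV : (x, c) ∈ V := ⟨⟨(x, c), hW⟩, hxO, rfl⟩
  by_cases hz : s.1 ⟨(x, c), hW⟩ = 0
  · refine ⟨⊤, V, hV, le_top, hxV, fun _ _ => trivial, 0, ?_⟩
    apply Subtype.ext
    funext p
    exact ((hVc p.1 p.2).trans hz).symm
  · let W' : Opens (Cyl X) := ⟨{p | p.1 ∉ D} ∩ {p | 0 < p.2},
      (hD.isOpen_compl.preimage continuous_fst).inter
        (isOpen_lt continuous_const continuous_snd)⟩
    have hxc : (x, c) ∉ cylSet D := fun hmem => hz (s.2.2 ⟨(x, c), hW⟩ hmem)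
    have hxD : x ∉ D := fun hmem => hxc (Or.inl hmem)
    have hc : 0 < c := lt_of_le_of_ne c.2.1 (fun h0 => hxc (Or.inr h0.symm))
    refine ⟨W', V ⊓ W', inf_le_left.trans hV, inf_le_right, ⟨hxV, hxD, hc⟩,
      fun u hu => ⟨hxD, hc.trans_le hu⟩,
      ⟨fun _ => s.1 ⟨(x, c), hW⟩, IsLocallyConstant.const _, ?_⟩, ?_⟩
    · rintro ⟨p, hp⟩ (h1 | h1)
      · exact (hp.1 h1).elim
      · exact (hp.2.ne' h1).elim
    · apply Subtype.ext
      funext p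
      exact (hVc p.1 p.2.1).symm

/-- A locally constant function on a cylinder is constant on its fibers, so it vanishes if it
vanishes on the bottom. -/
lemma section_eq_zero {D : Set X} {U : Opens X}
    (s : extByZeroSections (cylSet D) ((Opens.map (cylProj X)).obj U)) : s = 0 := by
  apply Subtype.ext
  funext p
  let γ : unitInterval → (Opens.map (cylProj X)).obj U := fun t => ⟨(p.1.1, t), p.2⟩
  have h := (s.2.1.comp_continuous (f := γ) (by fun_prop)).apply_eq_of_isPreconnected
    isPreconnected_univ (Set.mem_univ p.1.2) (Set.mem_univ 0)
  exact h.trans (s.2.2 (γ 0) (Or.inr rfl))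

/-- Relative to its bottom and to the part over `D`, the cylinder has no cohomology. -/
lemma acyclic_cylSet {D : Set X} (hD : IsClosed D) : Acyclic (X × unitInterval) (cylSet D) := by
  intro k
  cases k with
  | zero =>
    have : Subsingleton (constSheaf (X × unitInterval) ⟶ extByZero (cylSet D)) :=
      ⟨fun f g => (sec_bijective (X := Cyl X) (extByZero (cylSet D))).1
        ((section_eq_zero (U := ⊤) (sec (X := Cyl X) f)).trans
          (section_eq_zero (U := ⊤) (sec (X := Cyl X) g)).symm)⟩
    exact Abelian.Ext.homEquiv₀.injective.subsingleton
  | succ k =>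
    refine ext_subsingleton_of_rightExtendable k _ (rightExtendable_extByZero hD) ?_
    apply Limits.IsZero.injective
    rw [Limits.IsZero.iff_id_eq_zero]
    ext U s
    exact section_eq_zero (U := U.unop) s

/-- A pair `(X, D)` has no cohomology if `X` can be contracted into `D`, by a homotopy that
preserves `D`. -/
theorem acyclic_of_contraction {D : Set X} (hD : IsClosed D) (h : C(X × unitInterval, X))
    (h1 : ∀ x, h (x, 1) = x) (h0 : ∀ x, h (x, 0) ∈ D) (hD' : ∀ x ∈ D, ∀ t, h (x, t) ∈ D) :
    Acyclic X D := by
  let i : C(X, X × unitInterval) := ⟨fun x => (x, 1), by fun_prop⟩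
  have hi : Topology.IsClosedEmbedding i := by
    refine Topology.IsClosedEmbedding.of_continuous_injective_isClosedMap i.continuous
      (fun x y hxy => congrArg Prod.fst hxy) (fun C hC => ?_)
    have : i '' C = C ×ˢ {1} := by
      ext ⟨x, t⟩
      simp [i, eq_comm]
    rw [this]
    exact hC.prod isClosed_singleton
  have hih : TopCat.ofHom i ≫ TopCat.ofHom h = 𝟙 (TopCat.of X) := by
    ext x
    exact h1 x
  refine ext_subsingleton_of_retract (X := TopCat.of X) (Y := Cyl X) (TopCat.ofHom h)
    (TopCat.ofHom i) hih hi
    (homOfSections (D' := cylSet D) h ?_) (homOfSections (D := cylSet D) i ?_) ?_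
    (acyclic_cylSet hD)
  · rintro ⟨x, t⟩ (hx | rfl)
    · exact hD' x hx t
    · exact h0 x
  · exact fun x hx => Or.inl hx
  · ext U s
    apply Subtype.ext
    funext x
    exact congrArg s.1 (Subtype.ext (h1 x.1))

end Contraction

/-! ### The constant sheaf -/

section ConstantSheaf

variable {X : Type} [TopologicalSpace X]

/-- The map from the constant presheaf to the locally constant functions. -/
def constToExtByZero (X : Type) [TopologicalSpace X] :
    (Functor.const (Opens (TopCat.of X))ᵒᵖ).obj (ModuleCat.of ℂ ℂ) ⟶
      (extByZero (∅ : Set X)).obj where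
  app _ := ModuleCat.ofHom
    { toFun c := ⟨fun _ => c, IsLocallyConstant.const c, fun _ h => h.elim⟩
      map_add' _ _ := rfl
      map_smul' _ _ := rfl }
  naturality _ _ _ := rfl

lemma isLocallyInjective_constToExtByZero :
    Presheaf.IsLocallyInjective (Opens.grothendieckTopology (TopCat.of X))
      (constToExtByZero X) where
  equalizerSieve_mem {V} a b hab x hx := by
    have h : (a : ℂ) = b := congrFun (congrArg Subtype.val hab) ⟨x, hx⟩
    exact ⟨V.unop, 𝟙 _, h, hx⟩

lemma isLocallySurjective_constToExtByZero :
    TopCat.Presheaf.IsLocallySurjective (X := TopCat.of X) (constToExtByZero X) := by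
  rw [TopCat.Presheaf.isLocallySurjective_iff]
  intro U t x hx
  obtain ⟨O, hO, hxO, hOc⟩ :=
    (show extByZeroSections ∅ U from t).2.1.exists_open ⟨x, hx⟩
  refine ⟨⟨Subtype.val '' O, U.isOpen.isOpenEmbedding_subtypeVal.isOpenMap O hO⟩, ?_,
    ⟨(show extByZeroSections ∅ U from t).1 ⟨x, hx⟩, ?_⟩, ⟨⟨x, hx⟩, hxO, rfl⟩⟩
  · rintro _ ⟨p, -, rfl⟩
    exact p.2
  · apply Subtype.ext
    funext ⟨_, p, hp, rfl⟩
    exact (hOc p hp).symm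

/-- The constant sheaf is the sheaf of locally constant functions. -/
lemma exists_constSheaf_iso (X : Type) [TopologicalSpace X] :
    Nonempty (constSheaf X ≅ extByZero (∅ : Set X)) := by
  have := isLocallyInjective_constToExtByZero (X := X)
  have : Presheaf.IsLocallySurjective (Opens.grothendieckTopology (TopCat.of X))
      (constToExtByZero X) := isLocallySurjective_constToExtByZero
  have hW := GrothendieckTopology.W_of_isLocallyBijective
    (J := Opens.grothendieckTopology (TopCat.of X)) (constToExtByZero X)
  rw [GrothendieckTopology.W_iff] at hW
  exact ⟨@asIso _ _ _ _ _ hW ≪≫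
    asIso ((sheafificationAdjunction (Opens.grothendieckTopology (TopCat.of X))
      (ModuleCat.{0} ℂ)).counit.app (extByZero ∅))⟩

/-- Cohomology relative to the empty set is cohomology. -/
lemma relCohomology_empty_equiv (X : Type) [TopologicalSpace X] (k : ℕ) :
    Nonempty (RelCohomology X ∅ k ≃ₗ[ℂ] Cohomology X k) := by
  obtain ⟨e⟩ := exists_constSheaf_iso X
  refine ⟨LinearEquiv.ofBijective
    (extPostcomp (constSheaf X) (Abelian.Ext.mk₀ e.inv) k k (add_zero k)) ⟨?_, ?_⟩⟩
  · refine Function.LeftInverse.injective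
      (g := extPostcomp (constSheaf X) (Abelian.Ext.mk₀ e.hom) k k (add_zero k)) fun x => ?_
    change (x.comp (Abelian.Ext.mk₀ e.inv) (add_zero k)).comp
      (Abelian.Ext.mk₀ e.hom) (add_zero k) = x
    simp
  · refine Function.RightInverse.surjective
      (g := extPostcomp (constSheaf X) (Abelian.Ext.mk₀ e.hom) k k (add_zero k)) fun x => ?_
    change (x.comp (Abelian.Ext.mk₀ e.hom) (add_zero k)).comp
      (Abelian.Ext.mk₀ e.inv) (add_zero k) = x
    simp

end ConstantSheaf

/-! ### Excision -/

section Excision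

variable {X : Type} [TopologicalSpace X]

/-- If `N` is acyclic relative to `D`, and `N`, `M` are a closed cover, then cohomology relative to
`D` is that of `M` relative to `D` and `N`. -/
lemma relCohomology_equiv_of_closed_cover {D N M : Set X} (hD : IsClosed D) (hN : IsClosed N)
    (hM : IsClosed M) (hMN : N ∪ M = Set.univ) (hac : Acyclic N (Subtype.val ⁻¹' D)) (k : ℕ) :
    Nonempty (RelCohomology X D k ≃ₗ[ℂ] RelCohomology M (Subtype.val ⁻¹' (D ∪ N)) k) := by
  obtain ⟨e⟩ := enlarge_equiv hD (f := ⟨Subtype.val, continuous_subtype_val⟩)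
    hN.isClosedEmbedding_subtypeVal hac k
  have hr : Set.range (⟨Subtype.val, continuous_subtype_val⟩ : C(N, X)) = N :=
    Subtype.range_val
  rw [hr] at e
  have hr' : Set.range (⟨Subtype.val, continuous_subtype_val⟩ : C(M, X)) = M :=
    Subtype.range_val
  obtain ⟨e'⟩ := restrict_equiv (hD.union hN) (f := ⟨Subtype.val, continuous_subtype_val⟩)
    hM.isClosedEmbedding_subtypeVal (by
      rw [hr', Set.union_assoc, hMN, Set.union_univ]
      exact acyclic_univ) k
  exact ⟨e.symm.trans e'⟩

/-- Cohomology relative to `D` can be computed on a subset `O`, if the closed sets `N` and `M ⊆ O`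
cover the space and `N` contracts into `D` by a homotopy that preserves `D` and `O`: both sides are
the cohomology of `M` relative to `D` and `N`. -/
theorem relCohomology_restrict_equiv {D N M O : Set X} (hD : IsClosed D) (hN : IsClosed N)
    (hM : IsClosed M) (hMN : N ∪ M = Set.univ) (hMO : M ⊆ O) (h : C(N × unitInterval, N))
    (h1 : ∀ x, h (x, 1) = x) (h0 : ∀ x, (h (x, 0) : X) ∈ D)
    (hD' : ∀ x : N, (x : X) ∈ D → ∀ t, (h (x, t) : X) ∈ D)
    (hO : ∀ x : N, (x : X) ∈ O → ∀ t, (h (x, t) : X) ∈ O) (k : ℕ) :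
    Nonempty (RelCohomology X D k ≃ₗ[ℂ] RelCohomology O (Subtype.val ⁻¹' D) k) := by
  have hac : Acyclic N (Subtype.val ⁻¹' D) :=
    acyclic_of_contraction (hD.preimage continuous_subtype_val) h h1 h0 hD'
  obtain ⟨e⟩ := relCohomology_equiv_of_closed_cover hD hN hM hMN hac k
  let N' : Set O := Subtype.val ⁻¹' N
  let M' : Set O := Subtype.val ⁻¹' M
  let D' : Set O := Subtype.val ⁻¹' D
  have hac' : Acyclic N' (Subtype.val ⁻¹' D') := by
    let j : N' × unitInterval → N × unitInterval := fun p => (⟨p.1.1.1, p.1.2⟩, p.2)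
    have hj : Continuous j := by fun_prop
    let h' : C(N' × unitInterval, N') :=
      ⟨fun p => ⟨⟨h (j p), hO (j p).1 p.1.1.2 p.2⟩, (h (j p)).2⟩, by fun_prop⟩
    refine acyclic_of_contraction ((hD.preimage continuous_subtype_val).preimage
      continuous_subtype_val) h' (fun x => ?_) (fun x => h0 _) (fun x hx t => hD' (j (x, t)).1 hx t)
    have hx : (h ((j (x, 1)).1, 1) : X) = (j (x, 1)).1 := congrArg Subtype.val (h1 (j (x, 1)).1)
    exact Subtype.ext (Subtype.ext hx)
  obtain ⟨e'⟩ := relCohomology_equiv_of_closed_cover (hD.preimage continuous_subtype_val)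
    (hN.preimage continuous_subtype_val) (hM.preimage continuous_subtype_val) (by
      rw [← Set.preimage_union, hMN, Set.preimage_univ]) hac' k
  let φ : M ≃ₜ M' :=
    { toFun m := ⟨⟨m.1, hMO m.2⟩, m.2⟩
      invFun m := ⟨m.1.1, m.2⟩
      left_inv _ := rfl
      right_inv _ := rfl
      continuous_toFun := by fun_prop
      continuous_invFun := by fun_prop }
  obtain ⟨e''⟩ := relCohomology_homeomorph φ (D := Subtype.val ⁻¹' (D' ∪ N'))
    (((hD.union hN).preimage continuous_subtype_val).preimage continuous_subtype_val) k
  exact ⟨e.trans (e'.trans e'').symm⟩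

end Excision

/-! ### Cohomology of simplices relative to their boundary -/

section Simplex

variable {U : Type} [TopologicalSpace U]

/-- The affine hyperplane `∑ c_i = 1` in `ℂ^r`. -/
abbrev AffineSimplex (r : ℕ) : Type := {c : Fin r → ℂ // ∑ i, c i = 1}

/-- The union of the coordinate hyperplanes in `U × AffineSimplex r`. -/
def simplexBoundary (U : Type) (r : ℕ) : Set (U × AffineSimplex r) := {p | ∃ i, p.2.1 i = 0}

/-- The union of all coordinate hyperplanes but the one of index zero. -/
def simplexHorn (U : Type) (r : ℕ) : Set (U × AffineSimplex (r + 1)) :=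
  {p | ∃ i : Fin r, p.2.1 i.succ = 0}

@[fun_prop]
lemma continuous_simplexCoord {r : ℕ} {Y : Type} [TopologicalSpace Y]
    {g : Y → U × AffineSimplex r} (hg : Continuous g) (i : Fin r) :
    Continuous fun y => (g y).2.1 i :=
  (continuous_apply i).comp (continuous_subtype_val.comp (continuous_snd.comp hg))

lemma isClosed_simplexHorn (r : ℕ) : IsClosed (simplexHorn U r) := by
  have : simplexHorn U r = ⋃ i : Fin r, {p | p.2.1 i.succ = 0} := by
    ext p
    simp [simplexHorn]
  rw [this]
  exact isClosed_iUnion_of_finite fun i => isClosed_eq (by fun_prop) continuous_const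

/-- The homotopy moves each point on a line to the vertex `(1, 0, …, 0)`, which lies on the horn as
there is at least one other coordinate. -/
lemma acyclic_simplexHorn (r : ℕ) :
    Acyclic (U × AffineSimplex (r + 2)) (simplexHorn U (r + 1)) := by
  let h : C((U × AffineSimplex (r + 2)) × unitInterval, U × AffineSimplex (r + 2)) :=
    ⟨fun p => (p.1.1, ⟨Fin.cons (1 - (p.2 : ℝ) * (1 - p.1.2.1 0))
      (fun i => (p.2 : ℝ) * p.1.2.1 i.succ), by
        have := p.1.2.2
        rw [Fin.sum_univ_succ] at this ⊢
        simp only [Fin.cons_zero, Fin.cons_succ, ← Finset.mul_sum]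
        linear_combination (p.2 : ℂ) * this⟩), by
      refine Continuous.prodMk (by fun_prop) (Continuous.subtype_mk (continuous_pi fun i => ?_) _)
      refine Fin.cases ?_ (fun i => ?_) i
      · simp only [Fin.cons_zero]
        fun_prop
      · simp only [Fin.cons_succ]
        fun_prop⟩
  refine acyclic_of_contraction (isClosed_simplexHorn _) h ?_ ?_ ?_
  · rintro ⟨u, c, hc⟩
    refine Prod.ext rfl (Subtype.ext (funext fun i => ?_))
    refine Fin.cases ?_ (fun i => ?_) i
    · simp [h]
    · simp [h]
  · rintro ⟨u, c, hc⟩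
    exact ⟨0, by simp [h]⟩
  · rintro ⟨u, c, hc⟩ ⟨i, hi⟩ t
    exact ⟨i, by simpa [h] using Or.inr hi⟩

/-- The inclusion of the face where the coordinate of index zero vanishes. -/
def simplexFace (U : Type) [TopologicalSpace U] (r : ℕ) :
    C(U × AffineSimplex r, U × AffineSimplex (r + 1)) :=
  ⟨fun p => (p.1, ⟨Fin.cons 0 p.2.1, by simpa [Fin.sum_univ_succ] using p.2.2⟩), by
    refine Continuous.prodMk (by fun_prop) (Continuous.subtype_mk (continuous_pi fun i => ?_) _)
    refine Fin.cases ?_ (fun i => ?_) i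
    · simp only [Fin.cons_zero]
      fun_prop
    · simp only [Fin.cons_succ]
      fun_prop⟩

lemma range_simplexFace (r : ℕ) :
    Set.range (simplexFace U r) = {p | p.2.1 0 = 0} := by
  ext ⟨u, c, hc⟩
  constructor
  · rintro ⟨p, hp⟩
    rw [← hp]
    rfl
  · intro h0
    have h0' : c 0 = 0 := h0
    refine ⟨(u, ⟨fun i => c i.succ, ?_⟩), Prod.ext rfl (Subtype.ext (funext fun i => ?_))⟩
    · rw [Fin.sum_univ_succ, h0', zero_add] at hc
      exact hc
    · refine Fin.cases h0'.symm (fun i => rfl) i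

lemma isClosedEmbedding_simplexFace (r : ℕ) :
    Topology.IsClosedEmbedding (simplexFace U r) := by
  let g : U × AffineSimplex (r + 1) → U × (Fin r → ℂ) := fun p => (p.1, fun i => p.2.1 i.succ)
  have hg : Continuous g := by fun_prop
  have hemb : Topology.IsEmbedding (g ∘ simplexFace U r) :=
    Topology.IsEmbedding.id.prodMap Topology.IsEmbedding.subtypeVal
  refine ⟨Topology.IsEmbedding.of_comp (simplexFace U r).continuous hg hemb, ?_⟩
  rw [range_simplexFace]
  exact isClosed_eq (by fun_prop) continuous_const

/-- The cohomology of `U × (∑ c_i = 1)` relative to the coordinate hyperplanes is that of `U`,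
shifted by the dimension of the simplex. The boundary consists of the horn, relative to which there
is no cohomology, and one face, which is a simplex of dimension one less. -/
theorem relCohomology_simplex (U : Type) [TopologicalSpace U] (r : ℕ) :
    (∀ m, Nonempty (RelCohomology (U × AffineSimplex (r + 1)) (simplexBoundary U (r + 1)) (m + r)
      ≃ₗ[ℂ] Cohomology U m)) ∧
    ∀ k < r, Subsingleton
      (RelCohomology (U × AffineSimplex (r + 1)) (simplexBoundary U (r + 1)) k) := by
  induction r with
  | zero =>
    refine ⟨fun m => ?_, fun k hk => (Nat.not_lt_zero k hk).elim⟩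
    let e : U ≃ₜ U × AffineSimplex 1 :=
      { toFun u := (u, ⟨fun _ => 1, by simp⟩)
        invFun := Prod.fst
        left_inv _ := rfl
        right_inv := by
          rintro ⟨u, c, hc⟩
          refine Prod.ext rfl (Subtype.ext (funext fun i => ?_))
          rw [Fin.sum_univ_one] at hc
          rw [Subsingleton.elim i 0]
          exact hc.symm
        continuous_toFun := by fun_prop
        continuous_invFun := by fun_prop }
    have hempty : simplexBoundary U 1 = ∅ := by
      rw [Set.eq_empty_iff_forall_notMem]
      rintro ⟨u, c, hc⟩ ⟨i, hi⟩
      rw [Fin.sum_univ_one] at hc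
      rw [Subsingleton.elim i 0] at hi
      exact one_ne_zero (hc.symm.trans hi)
    rw [hempty]
    obtain ⟨e₁⟩ := relCohomology_homeomorph e isClosed_empty m
    obtain ⟨e₂⟩ := relCohomology_empty_equiv U m
    exact ⟨e₁.trans e₂⟩
  | succ r ih =>
    have hunion : simplexHorn U (r + 1) ∪ Set.range (simplexFace U (r + 1)) =
        simplexBoundary U (r + 2) := by
      rw [range_simplexFace]
      ext p
      exact or_comm.trans (Fin.exists_fin_succ (P := fun i => p.2.1 i = 0)).symm
    have hpre : simplexFace U (r + 1) ⁻¹' simplexHorn U (r + 1) = simplexBoundary U (r + 1) := rfl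
    have hb := boundary_equiv (isClosed_simplexHorn (r + 1))
      (isClosedEmbedding_simplexFace (U := U) (r + 1)) (acyclic_simplexHorn r)
    rw [hunion, hpre] at hb
    refine ⟨fun m => ?_, fun k hk => ?_⟩
    · obtain ⟨e⟩ := hb (m + r)
      obtain ⟨e'⟩ := ih.1 m
      exact ⟨e.symm.trans e'⟩
    · cases k with
      | zero =>
        rw [← hunion]
        exact relCohomology_zero_subsingleton (isClosed_simplexHorn (r + 1))
          (isClosedEmbedding_simplexFace (U := U) (r + 1)) (acyclic_simplexHorn r)
      | succ k =>
        obtain ⟨e⟩ := hb k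
        have := ih.2 k (by omega)
        exact e.symm.injective.subsingleton

end Simplex

/-! ### Local generators of invertible sheaves -/

section LocalGenerator

variable {B : Scheme.{0}}

/-- A global section generates a sheaf of modules if its restrictions generate the sections over
each open set. -/
def Generates {X : Scheme.{0}} (M : X.Modules) (e : Γ(M, ⊤)) : Prop :=
  ∀ (V : X.Opens) (s : Γ(M, V)), ∃ g : Γ(X, V), s = g • M.presheaf.map (homOfLE le_top).op e

lemma exists_generates_unit (X : Scheme.{0}) :
    ∃ e, Generates (X := X) (SheafOfModules.unit X.ringCatSheaf : X.Modules) e := by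
  refine ⟨(1 : Γ(X, ⊤)), fun V s => ⟨s, ?_⟩⟩
  have h1 : X.presheaf.map (homOfLE le_top : V ⟶ ⊤).op 1 = 1 := map_one _
  change (show Γ(X, V) from s) =
    (show Γ(X, V) from s) * X.presheaf.map (homOfLE le_top : V ⟶ ⊤).op 1
  rw [h1, mul_one]

lemma Generates.of_iso {X : Scheme.{0}} {M N : X.Modules} (φ : M ≅ N) {e : Γ(N, ⊤)}
    (he : Generates N e) : Generates M (φ.inv.app ⊤ e) := by
  intro V s
  obtain ⟨g, hg⟩ := he V (φ.hom.app V s)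
  refine ⟨g, ?_⟩
  have h1 : φ.inv.app V (φ.hom.app V s) = s := by
    rw [← ConcreteCategory.comp_apply, ← Scheme.Modules.Hom.comp_app, φ.hom_inv_id]
    rfl
  rw [hg, Scheme.Modules.Hom.app_smul] at h1
  rw [← h1]
  congr 1
  exact ConcreteCategory.congr_hom (φ.inv.mapPresheaf.naturality (homOfLE le_top : V ⟶ ⊤).op) e

/-- An invertible sheaf is locally generated by one section. -/
lemma IsInvertible.exists_local_generator {L : B.Modules} (hL : IsInvertible L) (p : B) :
    ∃ (W : B.Opens) (e : Γ(L, W)), p ∈ W ∧ ∀ (V : B.Opens) (h : V ≤ W) (s : Γ(L, V)),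
      ∃ g : Γ(B, V), s = g • L.presheaf.map (homOfLE h).op e := by
  obtain ⟨U, hpU, ⟨φ⟩⟩ := hL p
  obtain ⟨e, he⟩ := exists_generates_unit U.toScheme
  have he' := he.of_iso φ
  refine ⟨U.ι ''ᵁ ⊤, φ.inv.app ⊤ e, by rwa [U.ι_image_top], fun V h s => ?_⟩
  obtain ⟨V, rfl⟩ : ∃ V' : U.toScheme.Opens, V = U.ι ''ᵁ V' := by
    refine ⟨U.ι ⁻¹ᵁ V, ?_⟩
    rw [U.ι_image_top] at h
    rw [Scheme.Hom.image_preimage_eq_opensRange_inf, Scheme.Opens.opensRange_ι,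
      inf_eq_right.2 h]
  obtain ⟨g, hg⟩ := he' V s
  exact ⟨(U.ι.appIso V).inv g, hg⟩

end LocalGenerator

/-! ### Fibers of sheaves of modules -/

section Fiber

variable {B : Scheme.{0}} {f : B ⟶ Spec (CommRingCat.of ℂ)}

/-- The value at a complex point of a regular function near it. -/
def evalAt (x : ComplexPoint f) {V : B.Opens} (h : x.pt ∈ V) (g : Γ(B, V)) : ℂ :=
  x.evalGerm (B.presheaf.germ V x.pt h g)

lemma continuous_evalAt {V : B.Opens} (g : Γ(B, V)) {Y : Type} [TopologicalSpace Y]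
    {x : Y → ComplexPoint f} (hx : Continuous x) (hV : ∀ y, (x y).pt ∈ V) :
    Continuous fun y => evalAt (x y) (hV y) g := by
  refine continuous_def.2 fun O hO => ?_
  have hS : IsOpen {x : ComplexPoint f | ∃ h : x.pt ∈ V, evalAt x h g ∈ O} :=
    isOpen_generateFrom_of_mem ⟨V, g, O, hO, rfl⟩
  convert! hS.preimage hx using 1
  ext y
  exact ⟨fun h => ⟨hV y, h⟩, fun h => h.2⟩

lemma isOpen_pt_mem (f : B ⟶ Spec (CommRingCat.of ℂ)) (V : B.Opens) :
    IsOpen {x : ComplexPoint f | x.pt ∈ V} := by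
  refine isOpen_generateFrom_of_mem ⟨V, 0, Set.univ, isOpen_univ, ?_⟩
  ext x
  exact ⟨fun h => ⟨h, trivial⟩, fun h => h.1⟩

lemma valueAt_smul (L : B.Modules) (x : ComplexPoint f) {V : B.Opens} (h : x.pt ∈ V)
    (g : Γ(B, V)) (s : Γ(L, V)) : valueAt L x h (g • s) = evalAt x h g • valueAt L x h s := by
  have h1 : L.presheaf.germ V x.pt h (g • s) =
      B.presheaf.germ V x.pt h g • L.presheaf.germ V x.pt h s :=
    PresheafOfModules.germ_smul L.val x.pt V h g s
  unfold valueAt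
  rw [h1, ← TensorProduct.smul_tmul, TensorProduct.smul_tmul', Algebra.smul_def, smul_eq_mul]
  rfl

lemma valueAt_res (L : B.Modules) (x : ComplexPoint f) {V W : B.Opens} (hVW : V ≤ W)
    (h : x.pt ∈ V) (s : Γ(L, W)) :
    valueAt L x h (L.presheaf.map (homOfLE hVW).op s) = valueAt L x (hVW h) s := by
  unfold valueAt
  rw [TopCat.Presheaf.germ_res_apply]

/-- The fiber is spanned by the values of local sections, which may be taken over arbitrarily
small open sets. -/
lemma fiber_induction (L : B.Modules) (x : ComplexPoint f) {W : B.Opens} (hW : x.pt ∈ W)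
    {P : Fiber L x → Prop} (h0 : P 0) (hadd : ∀ v w, P v → P w → P (v + w))
    (hs : ∀ (c : ℂ) (V : B.Opens) (h : x.pt ∈ V), V ≤ W → ∀ s : Γ(L, V),
      P (c • valueAt L x h s)) (v : Fiber L x) : P v := by
  induction v using TensorProduct.induction_on with
  | zero => exact h0
  | add v w hv hw => exact hadd v w hv hw
  | tmul c m =>
    obtain ⟨V, hV, s, rfl⟩ := TopCat.Presheaf.exists_germ_eq L.presheaf m
    have := hs c (V ⊓ W) ⟨hV, hW⟩ inf_le_right (L.presheaf.map (homOfLE inf_le_left).op s)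
    rw [valueAt_res L x (W := V) inf_le_left ⟨hV, hW⟩ s] at this
    unfold valueAt at this
    rwa [TensorProduct.smul_tmul', smul_eq_mul, mul_one] at this

/-- A nonzero vector spans the fiber of an invertible sheaf. -/
lemma IsInvertible.exists_dual {L : B.Modules} (hL : IsInvertible L) (x : ComplexPoint f)
    {v : Fiber L x} (hv : v ≠ 0) :
    ∃ δ : Module.Dual ℂ (Fiber L x), δ v = 1 ∧ ∀ w, w = δ w • v := by
  obtain ⟨W, e, hW, he⟩ := hL.exists_local_generator x.pt
  have hspan : ∀ w : Fiber L x, ∃ c : ℂ, w = c • valueAt L x hW e := by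
    refine fiber_induction L x hW ⟨0, (zero_smul _ _).symm⟩ ?_ ?_
    · rintro _ _ ⟨c, rfl⟩ ⟨d, rfl⟩
      exact ⟨c + d, (add_smul _ _ _).symm⟩
    · intro c V h hVW s
      obtain ⟨g, rfl⟩ := he V hVW s
      exact ⟨c * evalAt x h g, by rw [valueAt_smul, valueAt_res L x hVW, smul_smul]⟩
  obtain ⟨c, hc⟩ := hspan v
  have hc0 : c ≠ 0 := by
    rintro rfl
    exact hv (by rw [hc, zero_smul])
  obtain ⟨δ, hδ⟩ := Module.Projective.exists_dual_eq_one ℂ hv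
  refine ⟨δ, hδ, fun w => ?_⟩
  obtain ⟨d, rfl⟩ := hspan w
  have h2 : valueAt L x hW e = c⁻¹ • v := by rw [hc, smul_smul, inv_mul_cancel₀ hc0, one_smul]
  rw [map_smul, h2, map_smul, hδ, smul_eq_mul, smul_eq_mul, mul_one, smul_smul]

/-- Linear forms normalized by the condition `⟨δ, b(x)⟩ = 1` depend continuously on the point: if
`s = g e` and `b = g' e` for a local generator `e`, then `⟨δ, s(x)⟩ = g(x) / g'(x)`. -/
lemma IsInvertible.continuous_dual_apply {L : B.Modules} (hL : IsInvertible L) (b : Γ(L, ⊤))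
    {V : B.Opens} (s : Γ(L, V)) {Y : Type} [TopologicalSpace Y] {x : Y → ComplexPoint f}
    (hx : Continuous x) (hV : ∀ y, (x y).pt ∈ V) (δ : ∀ y, Module.Dual ℂ (Fiber L (x y)))
    (hδ : ∀ y, δ y (valueAt L (x y) (Opens.mem_top _) b) = 1) :
    Continuous fun y => δ y (valueAt L (x y) (hV y) s) := by
  refine continuous_iff_continuousAt.2 fun y₀ => ?_
  obtain ⟨W, e, hW, he⟩ := hL.exists_local_generator (x y₀).pt
  obtain ⟨g, hg⟩ := he (V ⊓ W) inf_le_right (L.presheaf.map (homOfLE inf_le_left).op s)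
  obtain ⟨g', hg'⟩ := he (V ⊓ W) inf_le_right (L.presheaf.map (homOfLE le_top).op b)
  let T : Set Y := {y | (x y).pt ∈ V ⊓ W}
  have hT : IsOpen T := (isOpen_pt_mem f (V ⊓ W)).preimage hx
  have hTy : y₀ ∈ T := ⟨hV y₀, hW⟩
  have hxT : Continuous fun y : T => x y := hx.comp continuous_subtype_val
  have key (y : T) : evalAt (x y) y.2 g' ≠ 0 ∧ δ y (valueAt L (x y) (hV y) s) =
      evalAt (x y) y.2 g / evalAt (x y) y.2 g' := by
    have h1 := congrArg (fun t => δ y (valueAt L (x y) y.2 t)) hg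
    have h2 := congrArg (fun t => δ y (valueAt L (x y) y.2 t)) hg'
    simp only [valueAt_smul, map_smul, smul_eq_mul] at h1 h2
    rw [valueAt_res L (x y) (W := V) inf_le_left] at h1
    rw [valueAt_res L (x y) (W := ⊤) le_top, hδ] at h2
    have h3 := left_ne_zero_of_mul (h2 ▸ one_ne_zero)
    refine ⟨h3, ?_⟩
    rw [h1, eq_div_iff h3]
    linear_combination (-evalAt (x y) y.2 g) * h2
  have hc : ContinuousOn (fun y => δ y (valueAt L (x y) (hV y) s)) T := by
    rw [continuousOn_iff_continuous_domRestrict]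
    have : T.domRestrict (fun y => δ y (valueAt L (x y) (hV y) s)) =
        fun y : T => evalAt (x y) y.2 g / evalAt (x y) y.2 g' := funext fun y => (key y).2
    rw [this]
    exact (continuous_evalAt g hxT fun y => y.2).div₀ (continuous_evalAt g' hxT fun y => y.2)
      fun y => (key y).1
  exact hc.continuousAt (hT.mem_nhds hTy)

end Fiber

/-! ### The topology of the vector bundle -/

section BundleTopology

variable {B : Scheme.{0}} {r : ℕ} {f : B ⟶ Spec (CommRingCat.of ℂ)} {L : Fin r → B.Modules}

lemma continuous_base : Continuous (BundlePoint.base : BundlePoint f L → ComplexPoint f) :=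
  continuous_def.2 fun W hW => isOpen_generateFrom_of_mem (Or.inl ⟨W, hW, rfl⟩)

lemma continuous_coord_apply {i : Fin r} {V : B.Opens} (s : Γ(L i, V)) {Y : Type}
    [TopologicalSpace Y] {p : Y → BundlePoint f L} (hp : Continuous p)
    (hV : ∀ y, (p y).base.pt ∈ V) :
    Continuous fun y => (p y).coord i (valueAt (L i) (p y).base (hV y) s) := by
  refine continuous_def.2 fun O hO => ?_
  have hS : IsOpen {p : BundlePoint f L | ∃ h : p.base.pt ∈ V,
      p.coord i (valueAt (L i) p.base h s) ∈ O} :=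
    isOpen_generateFrom_of_mem (Or.inr ⟨i, V, s, O, hO, rfl⟩)
  convert! hS.preimage hp using 1
  ext y
  exact ⟨fun h => ⟨hV y, h⟩, fun h => h.2⟩

/-- A map to the total space is continuous if the base point and the values of the linear forms on
local sections are. -/
lemma continuous_bundlePoint {Y : Type} [TopologicalSpace Y] {p : Y → BundlePoint f L}
    (hb : Continuous fun y => (p y).base)
    (hc : ∀ (i : Fin r) (V : B.Opens) (s : Γ(L i, V)),
      Continuous fun y : {y // (p y).base.pt ∈ V} =>
        (p y).coord i (valueAt (L i) (p y).base y.2 s)) : Continuous p := by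
  refine continuous_generateFrom_iff.2 ?_
  rintro _ (⟨W, hW, rfl⟩ | ⟨i, V, s, O, hO, rfl⟩)
  · exact hW.preimage hb
  · have hV : IsOpen {y | (p y).base.pt ∈ V} := (isOpen_pt_mem f V).preimage hb
    convert! hV.isOpenEmbedding_subtypeVal.isOpenMap _ (hO.preimage (hc i V s)) using 1
    ext y
    exact ⟨fun h => ⟨⟨y, h.1⟩, h.2, rfl⟩, by rintro ⟨z, hz, rfl⟩; exact ⟨z.2, hz⟩⟩

/-- The function `⟨ℓ_i, b_i(x)⟩` on the total space. -/
def coordPairing (b : ∀ i, Γ(L i, ⊤)) (i : Fin r) (p : BundlePoint f L) : ℂ :=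
  p.coord i (valueAt (L i) p.base (Opens.mem_top _) (b i))

lemma continuous_coordPairing (b : ∀ i, Γ(L i, ⊤)) (i : Fin r) :
    Continuous (coordPairing (f := f) b i) :=
  continuous_coord_apply (b i) continuous_id fun _ => Opens.mem_top _

lemma pairing_eq_sum (b : ∀ i, Γ(L i, ⊤)) (p : BundlePoint f L) :
    pairing b p = ∑ i, coordPairing b i p := rfl

lemma continuous_pairing (b : ∀ i, Γ(L i, ⊤)) : Continuous (pairing (f := f) b) :=
  continuous_finsetSum _ fun i _ => continuous_coordPairing b i

/-- Scaling of the `i`th coordinate by `c_i`. -/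
def scaleCoord (c : Fin r → ℂ) (p : BundlePoint f L) : BundlePoint f L :=
  ⟨p.base, fun i => c i • p.coord i⟩

lemma coordPairing_scaleCoord (b : ∀ i, Γ(L i, ⊤)) (i : Fin r) (c : Fin r → ℂ)
    (p : BundlePoint f L) : coordPairing b i (scaleCoord c p) = c i * coordPairing b i p := rfl

lemma scaleCoord_one (p : BundlePoint f L) : scaleCoord (fun _ => 1) p = p := by
  simp [scaleCoord]

lemma continuous_scaleCoord {Y : Type} [TopologicalSpace Y] {p : Y → BundlePoint f L}
    (hp : Continuous p) {c : Y → Fin r → ℂ} (hc : Continuous c) :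
    Continuous fun y => scaleCoord (c y) (p y) := by
  have hb : Continuous fun y => (p y).base := continuous_base.comp hp
  refine continuous_bundlePoint hb fun i V s => ?_
  exact (((continuous_apply i).comp hc).comp continuous_subtype_val).mul
    (continuous_coord_apply s (hp.comp continuous_subtype_val) fun y => y.2)

/-- If `ℓ_i ≠ 0`, then `⟨ℓ_i, s(x)⟩ ≠ 0` for a local section `s`, which is an open condition. -/
lemma isClosed_coordDivisor (i : Fin r) : IsClosed (coordDivisor f L i) := by
  rw [← isOpen_compl_iff, isOpen_iff_mem_nhds]
  intro p hp
  have hs : ∃ (V : B.Opens) (h : p.base.pt ∈ V) (s : Γ(L i, V)),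
      p.coord i (valueAt (L i) p.base h s) ≠ 0 := by
    by_contra! hs
    refine hp (LinearMap.ext fun v => ?_)
    refine fiber_induction (L i) p.base (Opens.mem_top _) (P := fun v => p.coord i v = 0)
      (map_zero (p.coord i)) ?_ ?_ v
    · intro v w hv hw
      rw [map_add, hv, hw]
      exact add_zero _
    · intro c V h _ s
      rw [map_smul, hs V h s]
      exact smul_zero c
  obtain ⟨V, h, s, hs⟩ := hs
  have hO : IsOpen {q : BundlePoint f L | ∃ h : q.base.pt ∈ V,
      q.coord i (valueAt (L i) q.base h s) ∈ ({0}ᶜ : Set ℂ)} :=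
    isOpen_generateFrom_of_mem (Or.inr ⟨i, V, s, {0}ᶜ, isOpen_compl_singleton, rfl⟩)
  refine Filter.mem_of_superset (hO.mem_nhds ⟨h, hs⟩) ?_
  rintro q ⟨hq, hq'⟩ hq0
  refine hq' ?_
  rw [show q.coord i = 0 from hq0]
  rfl

end BundleTopology

/-! ### Removing the zero loci from the Milnor fiber -/

section MilnorExcision

variable {B : Scheme.{0}} {r : ℕ} {f : B ⟶ Spec (CommRingCat.of ℂ)} {L : Fin r → B.Modules}

/-- The part of the Milnor fiber over the locus where the sections `b_i`, `i ∈ s`, do not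
vanish. -/
def nonvanishingPart (f : B ⟶ Spec (CommRingCat.of ℂ)) (b : ∀ i, Γ(L i, ⊤)) (s : Finset (Fin r)) :
    Set (milnorFiber f b) :=
  {p | ∀ i ∈ s, p.1.base ∉ zeroLocus f (b i)}

lemma isClosed_iUnion_milnorDivisor (b : ∀ i, Γ(L i, ⊤)) :
    IsClosed (⋃ i, milnorDivisor f b i) :=
  isClosed_iUnion_of_finite fun i => (isClosed_coordDivisor i).preimage continuous_subtype_val

/-- The factors that scale `ℓ_i` by `t`, and all other coordinates so as to preserve the equation
`∑ ⟨ℓ_j, b_j⟩ = 1`. -/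
def shrinkFactor (b : ∀ i, Γ(L i, ⊤)) (i : Fin r) (p : BundlePoint f L) (t : ℝ) : Fin r → ℂ :=
  fun j => if j = i then t else (1 - t * coordPairing b i p) / (1 - coordPairing b i p)

lemma pairing_shrink (b : ∀ i, Γ(L i, ⊤)) (i : Fin r) {p : BundlePoint f L}
    (hp : pairing b p = 1) (hi : coordPairing b i p ≠ 1) (t : ℝ) :
    pairing b (scaleCoord (shrinkFactor b i p t) p) = 1 := by
  have h1 : 1 - coordPairing b i p ≠ 0 := sub_ne_zero.2 hi.symm
  rw [pairing_eq_sum, ← Finset.add_sum_erase _ _ (Finset.mem_univ i)] at hp ⊢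
  have h2 : ∑ j ∈ Finset.univ.erase i, coordPairing b j (scaleCoord (shrinkFactor b i p t) p) =
      (1 - t * coordPairing b i p) / (1 - coordPairing b i p) *
        ∑ j ∈ Finset.univ.erase i, coordPairing b j p := by
    rw [Finset.mul_sum]
    refine Finset.sum_congr rfl fun j hj => ?_
    rw [coordPairing_scaleCoord, shrinkFactor, if_neg (Finset.ne_of_mem_erase hj)]
  rw [h2, coordPairing_scaleCoord, shrinkFactor, if_pos rfl, eq_sub_of_add_eq' hp,
    div_mul_cancel₀ _ h1]
  ring

/-- Removing the zero locus of `b_i` from the Milnor fiber does not change the cohomology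
relative to the coordinate divisors: near this locus `|⟨ℓ_i, b_i⟩| ≤ 1/2`, and the region where
this inequality holds contracts to `ℓ_i = 0`. -/
lemma relCohomology_insert (b : ∀ i, Γ(L i, ⊤)) (s : Finset (Fin r)) (i : Fin r) (k : ℕ) :
    Nonempty (RelCohomology (nonvanishingPart f b s)
        (Subtype.val ⁻¹' ⋃ i, milnorDivisor f b i) k ≃ₗ[ℂ]
      RelCohomology (nonvanishingPart f b (insert i s))
        (Subtype.val ⁻¹' ⋃ i, milnorDivisor f b i) k) := by
  let X := nonvanishingPart f b s
  let D : Set X := Subtype.val ⁻¹' ⋃ i, milnorDivisor f b i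
  have hD : IsClosed D := (isClosed_iUnion_milnorDivisor b).preimage continuous_subtype_val
  let u : X → ℂ := fun p => coordPairing b i p.1.1
  have hu : Continuous u := (continuous_coordPairing b i).comp (by fun_prop)
  let N : Set X := {p | ‖u p‖ ≤ 1 / 2}
  let M : Set X := {p | 1 / 2 ≤ ‖u p‖}
  let O : Set X := {p | p.1.1.base ∉ zeroLocus f (b i)}
  have hN1 (p : N) : u p ≠ 1 := by
    intro h
    have := p.2
    change ‖u p‖ ≤ 1 / 2 at this
    rw [h, norm_one] at this
    norm_num at this
  have hMO : M ⊆ O := by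
    intro p hp h0
    have h0' : valueAt (L i) p.1.1.base (Opens.mem_top _) (b i) = 0 := h0
    have hu0 : u p = 0 := by
      change p.1.1.coord i (valueAt (L i) p.1.1.base (Opens.mem_top _) (b i)) = 0
      rw [h0', map_zero]
    change 1 / 2 ≤ ‖u p‖ at hp
    rw [hu0, norm_zero] at hp
    norm_num at hp
  let h₀ : N × unitInterval → BundlePoint f L := fun q =>
    scaleCoord (shrinkFactor b i q.1.1.1.1 q.2) q.1.1.1.1
  have hh₀ : Continuous h₀ := by
    refine continuous_scaleCoord (by fun_prop) (continuous_pi fun j => ?_)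
    have hu' : Continuous fun q : N × unitInterval => coordPairing b i q.1.1.1.1 :=
      hu.comp (by fun_prop)
    unfold shrinkFactor
    split_ifs
    · fun_prop
    · exact (continuous_const.sub ((by fun_prop : Continuous fun q : N × unitInterval =>
        (((q.2 : ℝ) : ℂ))).mul hu')).div₀ (continuous_const.sub hu')
        fun q => sub_ne_zero.2 (hN1 q.1).symm
  have hu₀ (q : N × unitInterval) : coordPairing b i (h₀ q) = (q.2 : ℝ) * u q.1 := by
    rw [coordPairing_scaleCoord, shrinkFactor, if_pos rfl]
  have hN₀ (q : N × unitInterval) : ‖coordPairing b i (h₀ q)‖ ≤ 1 / 2 := by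
    rw [hu₀, norm_mul, Complex.norm_real, Real.norm_of_nonneg q.2.2.1]
    exact (mul_le_of_le_one_left (norm_nonneg _) q.2.2.2).trans q.1.2
  let h : C(N × unitInterval, N) :=
    ⟨fun q => ⟨⟨⟨h₀ q, pairing_shrink b i q.1.1.1.2 (hN1 q.1) q.2⟩, q.1.1.2⟩, hN₀ q⟩,
      ((hh₀.subtype_mk _).subtype_mk _).subtype_mk _⟩
  obtain ⟨e⟩ := relCohomology_restrict_equiv (X := X) (D := D) (N := N) (M := M) (O := O) hD
    (isClosed_le hu.norm continuous_const) (isClosed_le continuous_const hu.norm)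
    (Set.eq_univ_of_forall fun p => le_total ‖u p‖ (1 / 2)) hMO h
    (by
      intro q
      refine Subtype.ext (Subtype.ext (Subtype.ext ?_))
      change scaleCoord (shrinkFactor b i q.1.1.1 (1 : ℝ)) q.1.1.1 = q.1.1.1
      have : shrinkFactor b i q.1.1.1 (1 : ℝ) = fun _ => 1 := by
        funext j
        unfold shrinkFactor
        split_ifs
        · exact Complex.ofReal_one
        · rw [Complex.ofReal_one, one_mul, div_self (sub_ne_zero.2 (hN1 q).symm)]
      rw [this, scaleCoord_one])
    (by
      intro q
      refine Set.mem_iUnion.2 ⟨i, ?_⟩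
      change shrinkFactor b i q.1.1.1 (0 : ℝ) i • q.1.1.1.coord i = 0
      rw [shrinkFactor, if_pos rfl, Complex.ofReal_zero, zero_smul])
    (by
      intro q hq t
      obtain ⟨j, hj⟩ := Set.mem_iUnion.1 hq
      have hj' : q.1.1.1.coord j = 0 := hj
      refine Set.mem_iUnion.2 ⟨j, ?_⟩
      change shrinkFactor b i q.1.1.1 t j • q.1.1.1.coord j = 0
      rw [hj', smul_zero])
    (fun q hq t => hq) k
  let φ : nonvanishingPart f b (insert i s) ≃ₜ O :=
    { toFun p := ⟨⟨p.1, fun j hj => p.2 j (Finset.mem_insert_of_mem hj)⟩,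
        p.2 i (Finset.mem_insert_self i s)⟩
      invFun p := ⟨p.1.1, fun j hj => (Finset.mem_insert.1 hj).elim
        (fun h => h ▸ p.2) (p.1.2 j)⟩
      left_inv _ := rfl
      right_inv _ := rfl
      continuous_toFun := by fun_prop
      continuous_invFun := by fun_prop }
  obtain ⟨e'⟩ := relCohomology_homeomorph φ (hD.preimage continuous_subtype_val) k
  exact ⟨e.trans e'⟩

/-- The cohomology of the Milnor fiber relative to the coordinate divisors only depends on the
part over the locus where no `b_i` vanishes. -/
theorem relCohomology_nonvanishingPart (b : ∀ i, Γ(L i, ⊤)) (s : Finset (Fin r)) (k : ℕ) :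
    Nonempty (RelCohomology (milnorFiber f b) (⋃ i, milnorDivisor f b i) k ≃ₗ[ℂ]
      RelCohomology (nonvanishingPart f b s) (Subtype.val ⁻¹' ⋃ i, milnorDivisor f b i) k) := by
  induction s using Finset.induction_on with
  | empty =>
    let φ : nonvanishingPart f b ∅ ≃ₜ milnorFiber f b :=
      { toFun := Subtype.val
        invFun p := ⟨p, fun j hj => (Finset.notMem_empty j hj).elim⟩
        left_inv _ := rfl
        right_inv _ := rfl
        continuous_toFun := by fun_prop
        continuous_invFun := by fun_prop }
    exact relCohomology_homeomorph φ (isClosed_iUnion_milnorDivisor b) k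
  | insert i s _ ih =>
    obtain ⟨e⟩ := ih
    obtain ⟨e'⟩ := relCohomology_insert b s i k
    exact ⟨e.trans e'⟩

end MilnorExcision

/-! ### The Milnor fiber over the nonvanishing locus -/

section Trivialization

variable {B : Scheme.{0}} {r : ℕ} {f : B ⟶ Spec (CommRingCat.of ℂ)} {L : Fin r → B.Modules}

/-- The locus `U_1 ∩ ⋯ ∩ U_r` where no `b_i` vanishes. -/
abbrev nonvanishingBase (f : B ⟶ Spec (CommRingCat.of ℂ)) (b : ∀ i, Γ(L i, ⊤)) :
    Set (ComplexPoint f) :=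
  ⋂ i, (zeroLocus f (b i))ᶜ

lemma exists_normalized_dual (hL : ∀ i, IsInvertible (L i)) (b : ∀ i, Γ(L i, ⊤))
    (x : nonvanishingBase f b) (i : Fin r) :
    ∃ δ : Module.Dual ℂ (Fiber (L i) x.1),
      δ (valueAt (L i) x.1 (Opens.mem_top _) (b i)) = 1 ∧
        ∀ w, w = δ w • valueAt (L i) x.1 (Opens.mem_top _) (b i) :=
  (hL i).exists_dual x.1 (Set.mem_iInter.1 x.2 i)

/-- The linear form on `L_i(x)` that takes the value `1` on `b_i(x)`. -/
def normalizedDual (hL : ∀ i, IsInvertible (L i)) (b : ∀ i, Γ(L i, ⊤))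
    (x : nonvanishingBase f b) (i : Fin r) : Module.Dual ℂ (Fiber (L i) x.1) :=
  (exists_normalized_dual hL b x i).choose

lemma normalizedDual_apply (hL : ∀ i, IsInvertible (L i)) (b : ∀ i, Γ(L i, ⊤))
    (x : nonvanishingBase f b) (i : Fin r) :
    normalizedDual hL b x i (valueAt (L i) x.1 (Opens.mem_top _) (b i)) = 1 :=
  (exists_normalized_dual hL b x i).choose_spec.1

lemma eq_smul_normalizedDual (hL : ∀ i, IsInvertible (L i)) (b : ∀ i, Γ(L i, ⊤))
    (x : nonvanishingBase f b) (i : Fin r) (δ : Module.Dual ℂ (Fiber (L i) x.1)) :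
    δ = δ (valueAt (L i) x.1 (Opens.mem_top _) (b i)) • normalizedDual hL b x i := by
  refine LinearMap.ext fun w => ?_
  have h := congrArg δ ((exists_normalized_dual hL b x i).choose_spec.2 w)
  rw [map_smul, smul_eq_mul] at h
  rw [LinearMap.smul_apply, smul_eq_mul, mul_comm]
  exact h

/-- Over the locus where no `b_i` vanishes, the coordinates `⟨ℓ_i, b_i(x)⟩` identify the Milnor
fiber with the product of the base and the hyperplane `∑ c_i = 1`. -/
def trivialization (hL : ∀ i, IsInvertible (L i)) (b : ∀ i, Γ(L i, ⊤)) :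
    nonvanishingBase f b × AffineSimplex r ≃ₜ nonvanishingPart f b Finset.univ where
  toFun q := ⟨⟨⟨q.1.1, fun i => q.2.1 i • normalizedDual hL b q.1 i⟩, by
      change ∑ i, (q.2.1 i • normalizedDual hL b q.1 i) _ = 1
      refine Eq.trans (Finset.sum_congr rfl fun i _ => ?_) q.2.2
      rw [LinearMap.smul_apply, normalizedDual_apply, smul_eq_mul, mul_one]⟩,
    fun i _ => Set.mem_iInter.1 q.1.2 i⟩
  invFun p := (⟨p.1.1.base, Set.mem_iInter.2 fun i => p.2 i (Finset.mem_univ i)⟩,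
    ⟨fun i => coordPairing b i p.1.1, p.1.2⟩)
  left_inv q := by
    refine Prod.ext rfl (Subtype.ext (funext fun i => ?_))
    change (q.2.1 i • normalizedDual hL b q.1 i) _ = q.2.1 i
    rw [LinearMap.smul_apply, normalizedDual_apply, smul_eq_mul, mul_one]
  right_inv p := by
    obtain ⟨⟨⟨x, ℓ⟩, hp⟩, hx⟩ := p
    refine Subtype.ext (Subtype.ext ?_)
    change BundlePoint.mk x _ = BundlePoint.mk x ℓ
    congr 1
    funext i
    exact (eq_smul_normalizedDual hL b
      ⟨x, Set.mem_iInter.2 fun i => hx i (Finset.mem_univ i)⟩ i (ℓ i)).symm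
  continuous_toFun := by
    refine (Continuous.subtype_mk (continuous_bundlePoint ?_ fun i V s => ?_) _).subtype_mk _
    · fun_prop
    · have hx : Continuous fun y : {y : nonvanishingBase f b × AffineSimplex r //
          y.1.1.pt ∈ V} => (y.1.1 : ComplexPoint f) := by fun_prop
      exact (continuous_simplexCoord continuous_subtype_val i).mul
        ((hL i).continuous_dual_apply (b i) s hx (fun y => y.2)
          (fun y => normalizedDual hL b y.1.1 i) fun y => normalizedDual_apply hL b y.1.1 i)
  continuous_invFun := by
    have hp : Continuous fun p : nonvanishingPart f b Finset.univ => p.1.1 := by fun_prop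
    exact ((continuous_base.comp hp).subtype_mk _).prodMk
      ((continuous_pi fun i => (continuous_coordPairing b i).comp hp).subtype_mk _)

lemma preimage_trivialization (hL : ∀ i, IsInvertible (L i)) (b : ∀ i, Γ(L i, ⊤)) :
    trivialization hL b ⁻¹' (Subtype.val ⁻¹' ⋃ i, milnorDivisor f b i) =
      simplexBoundary (nonvanishingBase f b) r := by
  ext q
  refine Set.mem_iUnion.trans (exists_congr fun i => ?_)
  change q.2.1 i • normalizedDual hL b q.1 i = 0 ↔ q.2.1 i = 0
  refine ⟨fun h => ?_, fun h => by rw [h, zero_smul]⟩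
  have := congrArg (fun δ => δ (valueAt (L i) q.1.1 (Opens.mem_top _) (b i))) h
  simpa [normalizedDual_apply] using this

/-- The cohomology of the Milnor fiber relative to the coordinate divisors is that of a family of
simplices over `U_1 ∩ ⋯ ∩ U_r`, relative to their boundaries. -/
theorem relCohomology_milnorFiber (hL : ∀ i, IsInvertible (L i)) (b : ∀ i, Γ(L i, ⊤)) (k : ℕ) :
    Nonempty (RelCohomology (milnorFiber f b) (⋃ i, milnorDivisor f b i) k ≃ₗ[ℂ]
      RelCohomology (nonvanishingBase f b × AffineSimplex r)
        (simplexBoundary (nonvanishingBase f b) r) k) := by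
  obtain ⟨e⟩ := relCohomology_nonvanishingPart b Finset.univ k
  obtain ⟨e'⟩ := relCohomology_homeomorph (trivialization hL b)
    ((isClosed_iUnion_milnorDivisor b).preimage continuous_subtype_val) k
  rw [preimage_trivialization] at e'
  exact ⟨e.trans e'⟩

end Trivialization

/-! ### The Milnor fiber in the projective bundle -/

section Projectivization

variable {B : Scheme.{0}} {r : ℕ} {f : B ⟶ Spec (CommRingCat.of ℂ)} {L : Fin r → B.Modules}

lemma coord_ne_zero_of_pairing_ne_zero (b : ∀ i, Γ(L i, ⊤)) {p : BundlePoint f L}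
    (hp : pairing b p ≠ 0) : p.coord ≠ 0 := by
  intro h
  refine hp (Finset.sum_eq_zero fun i _ => ?_)
  rw [h]
  rfl

lemma pairing_smul (b : ∀ i, Γ(L i, ⊤)) (c : ℂ) (p : BundlePoint f L) :
    pairing b ⟨p.base, c • p.coord⟩ = c * pairing b p := by
  rw [pairing_eq_sum, pairing_eq_sum, Finset.mul_sum]
  rfl

/-- The multiple of a vector with `φ_b = 1`. -/
def normalize (b : ∀ i, Γ(L i, ⊤)) (p : {p : Punctured f L // pairing b p.1 ≠ 0}) :
    milnorFiber f b :=
  ⟨⟨p.1.1.base, (pairing b p.1.1)⁻¹ • p.1.1.coord⟩, by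
    change pairing b _ = 1
    rw [pairing_smul, inv_mul_cancel₀ p.2]⟩

lemma continuous_normalize (b : ∀ i, Γ(L i, ⊤)) : Continuous (normalize (f := f) b) := by
  have hp : Continuous fun p : {p : Punctured f L // pairing b p.1 ≠ 0} => p.1.1 :=
    continuous_subtype_val.comp continuous_subtype_val
  refine Continuous.subtype_mk (continuous_scaleCoord
    (c := fun p _ => (pairing b p.1.1)⁻¹) hp (continuous_pi fun i => ?_)) _
  exact ((continuous_pairing b).comp hp).inv₀ fun p => p.2

lemma normalize_eq_of_equiv (b : ∀ i, Γ(L i, ⊤))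
    (p q : {p : Punctured f L // pairing b p.1 ≠ 0}) (h : p.1 ≈ q.1) :
    normalize b p = normalize b q := by
  obtain ⟨⟨p, hp⟩, hp'⟩ := p
  obtain ⟨⟨q, hq⟩, hq'⟩ := q
  obtain ⟨c, hc, h⟩ := h
  dsimp only at h
  subst h
  refine Subtype.ext ?_
  change BundlePoint.mk p.base _ = BundlePoint.mk p.base _
  congr 1
  change (pairing b p)⁻¹ • p.coord = (pairing b ⟨p.base, c • p.coord⟩)⁻¹ • c • p.coord
  rw [pairing_smul, smul_smul, mul_inv, mul_comm c⁻¹, mul_assoc, inv_mul_cancel₀ hc, mul_one]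

lemma mk_preimage_nonvanishingLocus (b : ∀ i, Γ(L i, ⊤)) :
    ProjBundle.mk ⁻¹' nonvanishingLocus f b = {p : Punctured f L | pairing b p.1 ≠ 0} := by
  ext q
  refine ⟨?_, fun h => ⟨q, h, rfl⟩⟩
  rintro ⟨p, hp, hpq⟩
  obtain ⟨c, hc, h⟩ : p ≈ q := Quotient.exact hpq
  change pairing b q.1 ≠ 0
  rw [h, pairing_smul]
  exact mul_ne_zero hc hp

lemma isQuotientMap_projBundleMk :
    Topology.IsQuotientMap (ProjBundle.mk : Punctured f L → ProjBundle f L) :=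
  isQuotientMap_quotient_mk'

lemma isOpen_nonvanishingLocus (b : ∀ i, Γ(L i, ⊤)) : IsOpen (nonvanishingLocus f b) := by
  rw [← isQuotientMap_projBundleMk.isOpen_preimage, mk_preimage_nonvanishingLocus]
  exact isOpen_ne.preimage ((continuous_pairing b).comp continuous_subtype_val)

/-- The class of a vector with `φ_b = 1`. -/
def toNonvanishingLocus (b : ∀ i, Γ(L i, ⊤)) (p : milnorFiber f b) : nonvanishingLocus f b :=
  have hp : pairing b p.1 ≠ 0 := p.2 ▸ one_ne_zero
  ⟨ProjBundle.mk ⟨p.1, coord_ne_zero_of_pairing_ne_zero b hp⟩, _, hp, rfl⟩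

lemma continuous_toNonvanishingLocus (b : ∀ i, Γ(L i, ⊤)) :
    Continuous (toNonvanishingLocus (f := f) b) :=
  (isQuotientMap_projBundleMk.continuous.comp
    (Continuous.subtype_mk continuous_subtype_val _)).subtype_mk _

lemma mk_normalize (b : ∀ i, Γ(L i, ⊤)) (p : {p : Punctured f L // pairing b p.1 ≠ 0}) :
    (toNonvanishingLocus b (normalize b p) : ProjBundle f L) = ProjBundle.mk p.1 := by
  refine Quotient.sound ?_
  refine ⟨pairing b p.1.1, p.2, ?_⟩
  change p.1.1 = ⟨p.1.1.base, pairing b p.1.1 • (pairing b p.1.1)⁻¹ • p.1.1.coord⟩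
  rw [smul_smul, mul_inv_cancel₀ p.2, one_smul]

/-- The projection maps the Milnor fiber bijectively onto the locus `φ_b ≠ 0`, each class of which
has a unique representative with `φ_b = 1`. -/
lemma bijective_toNonvanishingLocus (b : ∀ i, Γ(L i, ⊤)) :
    Function.Bijective (toNonvanishingLocus (f := f) b) := by
  refine ⟨fun p q h => ?_, ?_⟩
  · have hpq := Quotient.exact (congrArg Subtype.val h)
    have key (p : milnorFiber f b) (hp : p.1.coord ≠ 0) (hp' : pairing b p.1 ≠ 0) :
        normalize b ⟨⟨p.1, hp⟩, hp'⟩ = p := by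
      refine Subtype.ext ?_
      change BundlePoint.mk p.1.base ((pairing b p.1)⁻¹ • p.1.coord) = p.1
      rw [show pairing b p.1 = 1 from p.2, inv_one, one_smul]
    have h1 (p : milnorFiber f b) : pairing b p.1 ≠ 0 := p.2 ▸ one_ne_zero
    rw [← key p (coord_ne_zero_of_pairing_ne_zero b (h1 p)) (h1 p),
      ← key q (coord_ne_zero_of_pairing_ne_zero b (h1 q)) (h1 q)]
    exact normalize_eq_of_equiv b _ _ hpq
  · rintro ⟨_, p, hp, rfl⟩
    exact ⟨normalize b ⟨p, hp⟩, Subtype.ext (mk_normalize b ⟨p, hp⟩)⟩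

lemma isOpenMap_toNonvanishingLocus (b : ∀ i, Γ(L i, ⊤)) :
    IsOpenMap (toNonvanishingLocus (f := f) b) := by
  intro O hO
  rw [(isOpen_nonvanishingLocus b).isOpenEmbedding_subtypeVal.isOpen_iff_image_isOpen,
    ← isQuotientMap_projBundleMk.isOpen_preimage]
  have hopen : IsOpen {p : Punctured f L | pairing b p.1 ≠ 0} :=
    isOpen_ne.preimage ((continuous_pairing b).comp continuous_subtype_val)
  convert! hopen.isOpenEmbedding_subtypeVal.isOpenMap _ (hO.preimage (continuous_normalize b))
    using 1
  ext p
  constructor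
  · rintro ⟨_, ⟨q, hq, rfl⟩, hqp⟩
    have hp : pairing b p.1 ≠ 0 := by
      have : p ∈ ProjBundle.mk ⁻¹' nonvanishingLocus f b := by
        change ProjBundle.mk p ∈ nonvanishingLocus f b
        rw [← hqp]
        exact Subtype.prop _
      rwa [mk_preimage_nonvanishingLocus] at this
    refine ⟨⟨p, hp⟩, ?_, rfl⟩
    have : normalize b ⟨p, hp⟩ = q := (bijective_toNonvanishingLocus b).1
      (Subtype.ext ((mk_normalize b ⟨p, hp⟩).trans hqp.symm))
    change normalize b ⟨p, hp⟩ ∈ O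
    rwa [this]
  · rintro ⟨q, hq, rfl⟩
    exact ⟨_, ⟨_, hq, rfl⟩, mk_normalize b q⟩

/-- The projection identifies the Milnor fiber with the locus `φ_b ≠ 0` in the projective
bundle. -/
def milnorHomeomorph (f : B ⟶ Spec (CommRingCat.of ℂ)) (b : ∀ i, Γ(L i, ⊤)) :
    milnorFiber f b ≃ₜ nonvanishingLocus f b :=
  (Equiv.ofBijective _ (bijective_toNonvanishingLocus b)).toHomeomorphOfContinuousOpen
    (continuous_toNonvanishingLocus b) (isOpenMap_toNonvanishingLocus b)

lemma milnorHomeomorph_preimage (b : ∀ i, Γ(L i, ⊤)) (i : Fin r) :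
    milnorHomeomorph f b ⁻¹' (Subtype.val ⁻¹' projDivisor f L i) = milnorDivisor f b i := by
  ext p
  constructor
  · rintro ⟨q, hq, hqp⟩
    obtain ⟨c, hc, h⟩ := Quotient.exact hqp
    change p.1.coord i = 0
    have h' : p.1 = ⟨q.1.base, c • q.1.coord⟩ := h
    rw [h']
    change c • q.1.coord i = 0
    rw [show q.1.coord i = 0 from hq, smul_zero]
  · intro hp
    exact ⟨_, hp, rfl⟩

end Projectivization

end MilnorFiber

end

theorem mainTheorem2 {B : Scheme.{0}} (f : B ⟶ Spec (CommRingCat.of ℂ)) (n r : ℕ)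
    [SmoothOfRelativeDimension n f] [IsSeparated f] [QuasiCompact f]
    (L : Fin r → B.Modules) (hL : ∀ i, IsInvertible (L i))
    (b : ∀ i, Γ(L i, ⊤)) (hb : b ≠ 0) :
    -- `H^{m+r-1}(F_b, ⋃ E_i) ≅ H^m(U_1 ∩ ⋯ ∩ U_r)`
    (∀ m k : ℕ, k + 1 = m + r →
      Nonempty (RelCohomology (milnorFiber f b) (⋃ i, milnorDivisor f b i) k ≃ₗ[ℂ]
        Cohomology (⋂ i, (zeroLocus f (b i))ᶜ : Set (ComplexPoint f)) m)) ∧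
    (∀ k : ℕ, k + 1 < r →
      Subsingleton (RelCohomology (milnorFiber f b) (⋃ i, milnorDivisor f b i) k)) ∧
    -- the projection identifies `(F_b, ⋃ E_i)` with `(𝕌_b, 𝕌_b ∩ 𝔻)`
    (∃ h : milnorFiber f b ≃ₜ nonvanishingLocus f b,
      (∀ p : milnorFiber f b, ∃ hp : p.1.coord ≠ 0,
        (h p : ProjBundle f L) = ProjBundle.mk ⟨p.1, hp⟩) ∧
      ∀ i, h '' milnorDivisor f b i = Subtype.val ⁻¹' projDivisor f L i) ∧
    -- `H^{m+r-1}(𝕌_b, 𝕌_b ∩ 𝔻) ≅ H^m(B ∖ ⋃ Y_i)`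
    (∀ m k : ℕ, k + 1 = m + r →
      Nonempty (RelCohomology (nonvanishingLocus f b)
          (Subtype.val ⁻¹' ⋃ i, projDivisor f L i) k ≃ₗ[ℂ]
        Cohomology ((⋃ i, zeroLocus f (b i))ᶜ : Set (ComplexPoint f)) m)) ∧
    (∀ k : ℕ, k + 1 < r →
      Subsingleton (RelCohomology (nonvanishingLocus f b)
        (Subtype.val ⁻¹' ⋃ i, projDivisor f L i) k)) := by
  -- For `r = 0` the families `b` and `0` agree.
  obtain _ | r := r
  · exact absurd (funext fun i => i.elim0) hb
  have hcoh : ∀ k, Nonempty (RelCohomology (milnorFiber f b) (⋃ i, milnorDivisor f b i) k ≃ₗ[ℂ]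
      RelCohomology (nonvanishingBase f b × AffineSimplex (r + 1))
        (simplexBoundary (nonvanishingBase f b) (r + 1)) k) := relCohomology_milnorFiber hL b
  have hproj : ∀ k, Nonempty (RelCohomology (nonvanishingLocus f b)
      (Subtype.val ⁻¹' ⋃ i, projDivisor f L i) k ≃ₗ[ℂ]
        RelCohomology (milnorFiber f b) (⋃ i, milnorDivisor f b i) k) := by
    intro k
    have hpre : milnorHomeomorph f b ⁻¹' (Subtype.val ⁻¹' ⋃ i, projDivisor f L i) =
        ⋃ i, milnorDivisor f b i := by
      rw [Set.preimage_iUnion, Set.preimage_iUnion]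
      exact Set.iUnion_congr (milnorHomeomorph_preimage b)
    rw [← hpre]
    refine relCohomology_homeomorph (milnorHomeomorph f b) ?_ k
    rw [← (milnorHomeomorph f b).isClosed_preimage, hpre]
    exact isClosed_iUnion_milnorDivisor b
  obtain ⟨hiso, hvan⟩ := relCohomology_simplex (nonvanishingBase f b) r
  have h1 : ∀ m k : ℕ, k + 1 = m + (r + 1) →
      Nonempty (RelCohomology (milnorFiber f b) (⋃ i, milnorDivisor f b i) k ≃ₗ[ℂ]
        Cohomology (nonvanishingBase f b) m) := by
    intro m k hk
    obtain rfl : k = m + r := by omega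
    obtain ⟨e⟩ := hcoh (m + r)
    obtain ⟨e'⟩ := hiso m
    exact ⟨e.trans e'⟩
  have h2 : ∀ k : ℕ, k + 1 < r + 1 →
      Subsingleton (RelCohomology (milnorFiber f b) (⋃ i, milnorDivisor f b i) k) := by
    intro k hk
    obtain ⟨e⟩ := hcoh k
    have := hvan k (by omega)
    exact e.injective.subsingleton
  refine ⟨h1, h2, ⟨milnorHomeomorph f b, fun p => ⟨_, rfl⟩, fun i => ?_⟩, fun m k hk => ?_,
    fun k hk => ?_⟩
  · rw [← milnorHomeomorph_preimage, Set.image_preimage_eq _ (milnorHomeomorph f b).surjective]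
  · rw [Set.compl_iUnion]
    obtain ⟨e⟩ := hproj k
    obtain ⟨e'⟩ := h1 m k hk
    exact ⟨e.trans e'⟩
  · obtain ⟨e⟩ := hproj k
    have := h2 k hk
    exact e.injective.subsingleton
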